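/- For a functor $F:\mathcal A\to\mathcal B$ between small categories let $MF$ be the category whose objects are pairs $(A,\,x:B\xrightarrow{\cong}FA)$, with $A$ an object of $\mathcal A$ and $x$ an isomorphism of $\mathcal B$, and whose arrows $(A,x:B\cong FA)\to(A',x':B'\cong FA')$ are pairs $(b:B\to B',\,a:A\to A')$ with $x'b=F(a)\,x$. Let $RF:MF\to\mathcal B$ be the functor $(A,x:B\cong FA)\mapsto B$ and let $LF:\mathcal A\to MF$ be the functor $A\mapsto(A,\mathrm{id}_{FA})$. A commutative square $(H,K):F\to G$ of functors ($KF=GH$) induces the functor $MF\to MG$, $(A,x)\mapsto(HA,Kx)$, so that $R$ is an endofunctor of the category $\mathbf{Cat}^{\mathbf 2}$ of arrows of $\mathbf{Cat}$. It is a monad with unit $(LF,\mathrm{id}_{\mathcal B}):F\to RF$ and multiplication $(\mu_F,\mathrm{id}_{\mathcal B}):RRF\to RF$, where $\mu_F\bigl((A,x:B\cong FA),\,x':B'\cong B\bigr)=(A,\,xx':B'\cong FA)$. (This is the monad of the algebraic weak factorisation system on $\mathbf{Cat}$ whose algebras are the split cloven isofibrations.) Let $R\text{-}\mathbf{Alg}$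 be the category of algebras for this monad, and let $S:R\text{-}\mathbf{Alg}\to\mathbf{Cat}$ be the functor that sends an algebra with underlying functor $F:\mathcal A\to\mathcal B$ to $\mathcal B$, and a morphism of algebras to the codomain part of its underlying square. Then $S$ is an elementary fibration. That is: $S$ is a Grothendieck fibration; $\mathbf{Cat}$ and every fibre of $S$ have finite products, and every reindexing functor $f^*$ preserves them; for all small categories $Y,X$, reindexing along the parametrised diagonal $\delta_{Y,X}=\langle \mathrm{pr}_1,\mathrm{pr}_2,\mathrm{pr}_2\rangle:Y\times X\to Y\times X\times X$ has a left adjoint $\Sigma_{Y,X}$; and these left adjoints satisfy * Frobenius Reciprocity: for all $Y,X$, every $A$ in the fibre over $Y\times X$ and every $B$ in the fibre over $Y\times X\times X$, the canonical arrow $\Sigma_{Y,X}(\delta_{Y,X}^*B\wedge A)\to B\wedge\Sigma_{Y,X}A$ is an isomorphism, where $\wedge$ denotes the product in a fibre; * the Beck–Chevalley Condition: for all $f:Y\to Z$ and $X$ in $\mathbf{Cat}$ and every $A$ in the fibre over $Z\times X$, the canonical arrow $\Sigma_{Y,X}(f\times X)^*A\to(f\times X\times X)^*\Sigma_{Z,X}A$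 is an isomorphism. -/

import Mathlib

universe v₁ v₂ u₁ u₂ u

namespace ElementaryFib

open CategoryTheory CategoryTheory.Limits CategoryTheory.Functor MonoidalCategory
  CartesianMonoidalCategory

/-! ### Reindexing in a fibration -/

section Fibrations

variable {E : Type u₂} {B : Type u₁} [Category.{v₂} E] [Category.{v₁} B]

instance fiberHom_isHomLift (p : E ⥤ B) {X : B} {A A' : Fiber p X} (g : A ⟶ A') :
    p.IsHomLift (𝟙 X) g.1 := g.2

open IsPreFibered in
/-- The reindexing functor `f^* : E_Y ⥤ E_X` along `f : X ⟶ Y`, for the chosen cleavage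
`IsPreFibered.pullbackMap`. -/
noncomputable def reindex (p : E ⥤ B) [p.IsFibered] {X Y : B} (f : X ⟶ Y) :
    Fiber p Y ⥤ Fiber p X where
  obj A := ⟨pullbackObj A.2 f, pullbackObj_proj A.2 f⟩
  map {A A'} g := ⟨IsCartesian.map p f (pullbackMap A'.2 f) (pullbackMap A.2 f ≫ g.1),
    inferInstance⟩
  map_id A := by
    apply Subtype.ext
    change IsCartesian.map p f (pullbackMap A.2 f) (pullbackMap A.2 f ≫ 𝟙 A.1) = 𝟙 _
    have : p.IsHomLift (𝟙 X) (𝟙 (pullbackObj A.2 f)) := IsHomLift.id (pullbackObj_proj A.2 f)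
    exact (IsCartesian.map_uniq p f _ _ _ (by rw [Category.id_comp, Category.comp_id])).symm
  map_comp {A A' A''} g h := by
    apply Subtype.ext
    change IsCartesian.map p f (pullbackMap A''.2 f) (pullbackMap A.2 f ≫ g.1 ≫ h.1) =
      IsCartesian.map p f (pullbackMap A'.2 f) (pullbackMap A.2 f ≫ g.1) ≫
        IsCartesian.map p f (pullbackMap A''.2 f) (pullbackMap A'.2 f ≫ h.1)
    refine (IsCartesian.map_uniq p f _ _ _ ?_).symm
    rw [Category.assoc, IsCartesian.fac, IsCartesian.fac_assoc, Category.assoc]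

/-- The chosen cartesian lift `f^* A ⟶ A` of `f : X ⟶ Y` into an object `A` over `Y`. -/
noncomputable def cartLift (p : E ⥤ B) [p.IsFibered] {X Y : B} (f : X ⟶ Y) (A : Fiber p Y) :
    ((reindex p f).obj A).1 ⟶ A.1 :=
  IsPreFibered.pullbackMap A.2 f

instance cartLift_isCartesian (p : E ⥤ B) [p.IsFibered] {X Y : B} (f : X ⟶ Y)
    (A : Fiber p Y) : p.IsCartesian f (cartLift p f A) :=
  inferInstanceAs (p.IsCartesian f (IsPreFibered.pullbackMap A.2 f))

/-- For a commutative square `u ≫ d' = d ≫ v` in the base, the canonical vertical comparison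
`u^* d'^* C ⟶ d^* v^* C`: the unique vertical arrow compatible with the cartesian lifts to `C`
(see `reindexSquare_fac`). -/
noncomputable def reindexSquare (p : E ⥤ B) [p.IsFibered] {W W' Z Z' : B} {u : W ⟶ W'}
    {d : W ⟶ Z} {d' : W' ⟶ Z'} {v : Z ⟶ Z'} (h : u ≫ d' = d ≫ v) (C : Fiber p Z') :
    (reindex p u).obj ((reindex p d').obj C) ⟶ (reindex p d).obj ((reindex p v).obj C) :=
  haveI : p.IsHomLift (d ≫ v)
      (cartLift p u ((reindex p d').obj C) ≫ cartLift p d' C) := by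
    rw [← h]; exact IsHomLift.comp p _ _ _ _
  ⟨IsCartesian.map p (d ≫ v) (cartLift p d ((reindex p v).obj C) ≫ cartLift p v C)
    (cartLift p u ((reindex p d').obj C) ≫ cartLift p d' C), inferInstance⟩

lemma reindexSquare_fac (p : E ⥤ B) [p.IsFibered] {W W' Z Z' : B} {u : W ⟶ W'}
    {d : W ⟶ Z} {d' : W' ⟶ Z'} {v : Z ⟶ Z'} (h : u ≫ d' = d ≫ v) (C : Fiber p Z') :
    (reindexSquare p h C).1 ≫ cartLift p d ((reindex p v).obj C) ≫ cartLift p v C =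
      cartLift p u ((reindex p d').obj C) ≫ cartLift p d' C :=
  haveI : p.IsHomLift (d ≫ v)
      (cartLift p u ((reindex p d').obj C) ≫ cartLift p d' C) := by
    rw [← h]; exact IsHomLift.comp p _ _ _ _
  IsCartesian.fac p (d ≫ v) (cartLift p d ((reindex p v).obj C) ≫ cartLift p v C) _

/-! ### Fibrations with finite products -/

/-- A fibration over a base with (chosen) finite products has finite products if every fibre has
finite products and every reindexing functor preserves them. -/
structure HasFibredProducts (p : E ⥤ B) [p.IsFibered] [CartesianMonoidalCategory B] : Prop where
  fibre : ∀ X : B, HasFiniteProducts (Fiber p X)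
  reindex : ∀ {X Y : B} (f : X ⟶ Y), PreservesFiniteProducts (reindex p f)

/-! ### Elementary fibrations -/

section Diagonal

variable [CartesianMonoidalCategory B]

/-- The parametrised diagonal `⟨pr₁, pr₂, pr₂⟩ : Y × X ⟶ Y × X × X`. -/
def parDiag (Y X : B) : Y ⊗ X ⟶ (Y ⊗ X) ⊗ X :=
  lift (𝟙 (Y ⊗ X)) (snd Y X)

lemma parDiag_naturality {Y Z : B} (f : Y ⟶ Z) (X : B) :
    (f ▷ X) ≫ parDiag Z X = parDiag Y X ≫ ((f ▷ X) ▷ X) := by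
  unfold parDiag
  ext <;> simp

end Diagonal

/-- The canonical arrow `L (d^* B' ∧ A) ⟶ B' ∧ L A` for a left adjoint `L` of `d^*`. Its first
component is the transpose of the projection `d^* B' ∧ A ⟶ d^* B'`. -/
noncomputable def frobeniusMap (p : E ⥤ B) [p.IsFibered] {W Z : B} [HasFiniteProducts (Fiber p W)]
    [HasFiniteProducts (Fiber p Z)] {d : W ⟶ Z} {L : Fiber p W ⥤ Fiber p Z}
    (adj : L ⊣ reindex p d) (A : Fiber p W) (B' : Fiber p Z) :
    L.obj ((reindex p d).obj B' ⨯ A) ⟶ B' ⨯ L.obj A :=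
  prod.lift ((adj.homEquiv _ _).symm prod.fst) (L.map prod.snd)

/-- The canonical arrow `L (u^* A) ⟶ v^* (L' A)` for a commutative square `u ≫ d' = d ≫ v` and
left adjoints `L` of `d^*` and `L'` of `d'^*`: the transpose of
`u^* A ⟶ u^* d'^* L' A ⟶ d^* v^* L' A`. -/
noncomputable def beckChevalleyMap (p : E ⥤ B) [p.IsFibered] {W W' Z Z' : B} {u : W ⟶ W'}
    {d : W ⟶ Z} {d' : W' ⟶ Z'} {v : Z ⟶ Z'} (h : u ≫ d' = d ≫ v)
    {L : Fiber p W ⥤ Fiber p Z} {L' : Fiber p W' ⥤ Fiber p Z'}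
    (adj : L ⊣ reindex p d) (adj' : L' ⊣ reindex p d') (A : Fiber p W') :
    L.obj ((reindex p u).obj A) ⟶ (reindex p v).obj (L'.obj A) :=
  (adj.homEquiv _ _).symm ((reindex p u).map (adj'.unit.app A) ≫ reindexSquare p h (L'.obj A))

/-- A functor is an elementary fibration if it is a fibration with finite products such that
reindexing along every parametrised diagonal has a left adjoint, and these left adjoints satisfy
Frobenius Reciprocity and the Beck-Chevalley Condition. -/
def IsElementaryFibration [CartesianMonoidalCategory B] (p : E ⥤ B) : Prop :=
  ∃ (_ : p.IsFibered) (hprod : HasFibredProducts p)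
    (L : ∀ Y X : B, Fiber p (Y ⊗ X) ⥤ Fiber p ((Y ⊗ X) ⊗ X))
    (adj : ∀ Y X : B, L Y X ⊣ reindex p (parDiag Y X)),
    (∀ (Y X : B) (A : Fiber p (Y ⊗ X)) (B' : Fiber p ((Y ⊗ X) ⊗ X)),
      haveI := hprod.fibre
      IsIso (frobeniusMap p (adj Y X) A B')) ∧
    (∀ (Y Z : B) (f : Y ⟶ Z) (X : B) (A : Fiber p (Z ⊗ X)),
      IsIso (beckChevalleyMap p (parDiag_naturality f X) (adj Y X) (adj Z X) A))

end Fibrations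

/-! ### The monad on `Cat^2` -/

section Factorisation

variable {𝒜 ℬ : Type u} [Category.{u} 𝒜] [Category.{u} ℬ]

/-- An object of `M F` is a pair `(A, x : B ≅ F A)`. -/
structure MObj (F : 𝒜 ⥤ ℬ) : Type u where
  src : 𝒜
  pt : ℬ
  iso : pt ≅ F.obj src

/-- An arrow `(A, x) ⟶ (A', x')` of `M F` is a pair `(b : B ⟶ B', a : A ⟶ A')` such that
`x' ∘ b = F a ∘ x`. -/
@[ext]
structure MHom {F : 𝒜 ⥤ ℬ} (P Q : MObj F) : Type u where
  b : P.pt ⟶ Q.pt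
  a : P.src ⟶ Q.src
  w : b ≫ Q.iso.hom = P.iso.hom ≫ F.map a

instance (F : 𝒜 ⥤ ℬ) : Category.{u} (MObj F) where
  Hom P Q := MHom P Q
  id P := ⟨𝟙 _, 𝟙 _, by simp⟩
  comp f g := ⟨f.b ≫ g.b, f.a ≫ g.a, by
    rw [Category.assoc, g.w, ← Category.assoc, f.w, Category.assoc, Functor.map_comp]⟩
  id_comp f := MHom.ext (Category.id_comp _) (Category.id_comp _)
  comp_id f := MHom.ext (Category.comp_id _) (Category.comp_id _)
  assoc f g h := MHom.ext (Category.assoc _ _ _) (Category.assoc _ _ _)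

/-- The projection `M F ⥤ 𝒜`, `(A, x) ↦ A`. -/
def srcFunctor (F : 𝒜 ⥤ ℬ) : MObj F ⥤ 𝒜 where
  obj P := P.src
  map f := f.a

/-- The right factor `R F : M F ⥤ ℬ`, `(A, x : B ≅ F A) ↦ B`. -/
def rightFactor (F : 𝒜 ⥤ ℬ) : MObj F ⥤ ℬ where
  obj P := P.pt
  map f := f.b

/-- The left factor `L F : 𝒜 ⥤ M F`, `A ↦ (A, id : F A ≅ F A)`. -/
def leftFactor (F : 𝒜 ⥤ ℬ) : 𝒜 ⥤ MObj F where
  obj A := ⟨A, F.obj A, Iso.refl _⟩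
  map a := ⟨F.map a, a, by simp⟩
  map_id A := MHom.ext (F.map_id A) rfl
  map_comp a a' := MHom.ext (F.map_comp a a') rfl

/-- The multiplication `M (R F) ⥤ M F`, `((A, x : B ≅ F A), x' : B' ≅ B) ↦ (A, x ∘ x')`. -/
def mulFunctor (F : 𝒜 ⥤ ℬ) : MObj (rightFactor F) ⥤ MObj F where
  obj P := ⟨P.src.src, P.pt, P.iso ≪≫ P.src.iso⟩
  map {P Q} f := ⟨f.b, f.a.a, by
    have h1 : f.b ≫ Q.iso.hom = P.iso.hom ≫ f.a.b := f.w
    have h2 := f.a.w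
    change f.b ≫ Q.iso.hom ≫ Q.src.iso.hom = (P.iso.hom ≫ P.src.iso.hom) ≫ F.map f.a.a
    exact (Category.assoc _ _ _).symm.trans ((congrArg (· ≫ Q.src.iso.hom) h1).trans
      ((Category.assoc _ _ _).trans ((congrArg (P.iso.hom ≫ ·) h2).trans
        (Category.assoc _ _ _).symm)))⟩

variable {𝒞 𝒟 : Type u} [Category.{u} 𝒞] [Category.{u} 𝒟]

/-- The action of `M` on a strictly commutative square of functors:
`(A, x : B ≅ F A) ↦ (H A, K B ≅ K F A = G H A)`. -/
def mapFunctor {F : 𝒜 ⥤ ℬ} {G : 𝒞 ⥤ 𝒟} (H : 𝒜 ⥤ 𝒞) (K : ℬ ⥤ 𝒟) (h : F ⋙ K = H ⋙ G) :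
    MObj F ⥤ MObj G where
  obj P := ⟨H.obj P.src, K.obj P.pt, K.mapIso P.iso ≪≫ (eqToIso h).app P.src⟩
  map {P Q} f := ⟨K.map f.b, H.map f.a, by
    have h1 := (eqToIso h).hom.naturality f.a
    simp only [Functor.comp_map] at h1
    simp only [Iso.trans_hom, Functor.mapIso_hom, Iso.app_hom, Category.assoc]
    rw [← h1, ← Category.assoc, ← K.map_comp, f.w, K.map_comp, Category.assoc]⟩
  map_id P := MHom.ext (K.map_id _) (H.map_id _)
  map_comp f g := MHom.ext (K.map_comp _ _) (H.map_comp _ _)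

lemma MObj.ext' {F : 𝒜 ⥤ ℬ} {P Q : MObj F} (hs : P.src = Q.src) (hp : P.pt = Q.pt)
    (hi : P.iso.hom = eqToHom hp ≫ Q.iso.hom ≫ eqToHom (by rw [hs])) : P = Q := by
  obtain ⟨s, b, x⟩ := P
  obtain ⟨s', b', x'⟩ := Q
  obtain rfl : s = s' := hs
  obtain rfl : b = b' := hp
  obtain rfl : x = x' := by
    ext
    simpa using hi
  rfl

lemma MHom.heq {F : 𝒜 ⥤ ℬ} {P Q P' Q' : MObj F} (hP : P = P') (hQ : Q = Q') (f : MHom P Q)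
    (g : MHom P' Q') (hb : f.b ≍ g.b) (ha : f.a ≍ g.a) : f ≍ g := by
  subst hP hQ
  exact heq_of_eq (MHom.ext (eq_of_heq hb) (eq_of_heq ha))

/-- Two functors into `M F` agree if they have the same projections and the same isomorphisms. -/
lemma functor_ext_to_M {F : 𝒜 ⥤ ℬ} {H K : 𝒞 ⥤ MObj F} (hs : H ⋙ srcFunctor F = K ⋙ srcFunctor F)
    (hp : H ⋙ rightFactor F = K ⋙ rightFactor F)
    (hi : ∀ C, (H.obj C).iso.hom = eqToHom (Functor.congr_obj hp C) ≫ (K.obj C).iso.hom ≫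
      eqToHom (congrArg F.obj (Functor.congr_obj hs C).symm)) : H = K := by
  have hobj : ∀ C, H.obj C = K.obj C := fun C =>
    MObj.ext' (Functor.congr_obj hs C) (Functor.congr_obj hp C) (hi C)
  refine Functor.hext hobj fun C D f => ?_
  refine MHom.heq (hobj C) (hobj D) _ _ ?_ ?_
  · have := Functor.congr_hom hp f
    exact (conj_eqToHom_iff_heq _ _ (Functor.congr_obj hp C) (Functor.congr_obj hp D)).1 this
  · have := Functor.congr_hom hs f
    exact (conj_eqToHom_iff_heq _ _ (Functor.congr_obj hs C) (Functor.congr_obj hs D)).1 this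

lemma mapFunctor_id (F : 𝒜 ⥤ ℬ) (h : F ⋙ 𝟭 ℬ = 𝟭 𝒜 ⋙ F) :
    mapFunctor (𝟭 𝒜) (𝟭 ℬ) h = 𝟭 (MObj F) := by
  refine functor_ext_to_M rfl rfl fun P => ?_
  change P.iso.hom ≫ (eqToHom h).app P.src = 𝟙 _ ≫ P.iso.hom ≫ 𝟙 _
  rw [eqToHom_app]
  exact (Category.id_comp _).symm

lemma mapFunctor_comp {𝒳 𝒴 : Type u} [Category.{u} 𝒳] [Category.{u} 𝒴] {F : 𝒜 ⥤ ℬ} {G : 𝒞 ⥤ 𝒟}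
    {I : 𝒳 ⥤ 𝒴} (H : 𝒜 ⥤ 𝒞) (K : ℬ ⥤ 𝒟) (h : F ⋙ K = H ⋙ G) (H' : 𝒞 ⥤ 𝒳) (K' : 𝒟 ⥤ 𝒴)
    (h' : G ⋙ K' = H' ⋙ I) (h'' : F ⋙ K ⋙ K' = (H ⋙ H') ⋙ I) :
    mapFunctor (H ⋙ H') (K ⋙ K') h'' = mapFunctor H K h ⋙ mapFunctor H' K' h' := by
  refine functor_ext_to_M rfl rfl fun P => ?_
  change K'.map (K.map P.iso.hom) ≫ (eqToHom h'').app P.src = 𝟙 _ ≫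
    (K'.map (K.map P.iso.hom ≫ (eqToHom h).app P.src) ≫ (eqToHom h').app (H.obj P.src)) ≫ 𝟙 _
  simp [eqToHom_app, eqToHom_map]

lemma leftFactor_naturality {F : 𝒜 ⥤ ℬ} {G : 𝒞 ⥤ 𝒟} (H : 𝒜 ⥤ 𝒞) (K : ℬ ⥤ 𝒟)
    (h : F ⋙ K = H ⋙ G) : H ⋙ leftFactor G = leftFactor F ⋙ mapFunctor H K h := by
  refine functor_ext_to_M rfl h.symm fun A => ?_
  change 𝟙 (G.obj (H.obj A)) = eqToHom (Functor.congr_obj h.symm A) ≫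
    (K.map (𝟙 (F.obj A)) ≫ (eqToHom h).app A) ≫ 𝟙 _
  have e : (K.map (𝟙 (F.obj A)) ≫ (eqToHom h).app A) ≫ 𝟙 (G.obj (H.obj A)) =
      eqToHom (Functor.congr_obj h A) :=
    (Category.comp_id _).trans ((congrArg (· ≫ (eqToHom h).app A) (K.map_id _)).trans
      ((Category.id_comp _).trans (eqToHom_app h A)))
  exact ((congrArg (eqToHom (Functor.congr_obj h.symm A) ≫ ·) e).trans
    (eqToHom_trans (Functor.congr_obj h.symm A) (Functor.congr_obj h A))).symm

lemma mulFunctor_naturality {F : 𝒜 ⥤ ℬ} {G : 𝒞 ⥤ 𝒟} (H : 𝒜 ⥤ 𝒞) (K : ℬ ⥤ 𝒟)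
    (h : F ⋙ K = H ⋙ G) (h' : rightFactor F ⋙ K = mapFunctor H K h ⋙ rightFactor G) :
    mapFunctor (mapFunctor H K h) K h' ⋙ mulFunctor G = mulFunctor F ⋙ mapFunctor H K h := by
  refine functor_ext_to_M rfl rfl fun P => ?_
  change (K.map P.iso.hom ≫ 𝟙 _) ≫ (K.map P.src.iso.hom ≫ (eqToHom h).app P.src.src) =
    𝟙 _ ≫ (K.map (P.iso.hom ≫ P.src.iso.hom) ≫ (eqToHom h).app P.src.src) ≫ 𝟙 _
  rw [Category.comp_id, Category.id_comp, Category.comp_id]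
  exact (Category.assoc _ _ _).symm.trans
    (congrArg (· ≫ (eqToHom h).app P.src.src) (K.map_comp _ _).symm)

lemma mulFunctor_assoc (F : 𝒜 ⥤ ℬ)
    (h : rightFactor (rightFactor F) ⋙ 𝟭 ℬ = mulFunctor F ⋙ rightFactor F) :
    mapFunctor (mulFunctor F) (𝟭 ℬ) h ⋙ mulFunctor F =
      mulFunctor (rightFactor F) ⋙ mulFunctor F := by
  refine functor_ext_to_M rfl rfl fun P => ?_
  change (P.iso.hom ≫ 𝟙 _) ≫ (P.src.iso.hom ≫ P.src.src.iso.hom) =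
    𝟙 _ ≫ ((P.iso.hom ≫ P.src.iso.hom) ≫ P.src.src.iso.hom) ≫ 𝟙 _
  rw [Category.comp_id, Category.id_comp, Category.comp_id]
  exact (Category.assoc _ _ _).symm

lemma mulFunctor_left_unit (F : 𝒜 ⥤ ℬ) :
    leftFactor (rightFactor F) ⋙ mulFunctor F = 𝟭 (MObj F) := by
  refine functor_ext_to_M rfl rfl fun P => ?_
  change 𝟙 P.pt ≫ P.iso.hom = 𝟙 _ ≫ P.iso.hom ≫ 𝟙 _
  simp

lemma mulFunctor_right_unit (F : 𝒜 ⥤ ℬ) (h : F ⋙ 𝟭 ℬ = leftFactor F ⋙ rightFactor F) :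
    mapFunctor (leftFactor F) (𝟭 ℬ) h ⋙ mulFunctor F = 𝟭 (MObj F) := by
  refine functor_ext_to_M rfl rfl fun P => ?_
  change (P.iso.hom ≫ 𝟙 _) ≫ 𝟙 _ = 𝟙 _ ≫ P.iso.hom ≫ 𝟙 _
  simp

end Factorisation

lemma square_functor {F G : Arrow Cat.{u, u}} (s : F ⟶ G) :
    F.hom.toFunctor ⋙ s.right.toFunctor = s.left.toFunctor ⋙ G.hom.toFunctor :=
  congrArg Cat.Hom.toFunctor (Arrow.w s).symm

/-- The endofunctor `R` of `Cat^2`, sending `F : 𝒜 ⥤ ℬ` to `R F : M F ⥤ ℬ`. -/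
def rightFunctor : Arrow Cat.{u, u} ⥤ Arrow Cat.{u, u} where
  obj F := Arrow.mk (rightFactor F.hom.toFunctor).toCatHom
  map s := Arrow.homMk
    (mapFunctor s.left.toFunctor s.right.toFunctor (square_functor s)).toCatHom s.right rfl
  map_id _ := Arrow.hom_ext _ _ (Cat.ext (mapFunctor_id _ _)) rfl
  map_comp _ _ := Arrow.hom_ext _ _ (Cat.ext (mapFunctor_comp _ _ _ _ _ _ _)) rfl

/-- The monad `R` on `Cat^2`, with unit `L F : F ⟶ R F` and multiplication given by composition
of isomorphisms. -/
def rightMonad : Monad (Arrow Cat.{u, u}) where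
  toFunctor := rightFunctor
  η :=
    { app F := Arrow.homMk (leftFactor F.hom.toFunctor).toCatHom (𝟙 F.right) rfl
      naturality _ _ s :=
        Arrow.hom_ext _ _ (Cat.ext (leftFactor_naturality _ _ (square_functor s))) rfl }
  μ :=
    { app F := Arrow.homMk (mulFunctor F.hom.toFunctor).toCatHom (𝟙 F.right) rfl
      naturality _ _ s :=
        Arrow.hom_ext _ _ (Cat.ext (mulFunctor_naturality _ _ (square_functor s) rfl)) rfl }
  assoc _ := Arrow.hom_ext _ _ (Cat.ext (mulFunctor_assoc _ rfl)) rfl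
  left_unit _ := Arrow.hom_ext _ _ (Cat.ext (mulFunctor_left_unit _)) rfl
  right_unit _ := Arrow.hom_ext _ _ (Cat.ext (mulFunctor_right_unit _ rfl)) rfl

/-- The category of algebras for the monad `R`. -/
abbrev RAlg : Type (u + 1) := Monad.Algebra rightMonad.{u}

/-- The functor `S : R-Alg ⥤ Cat`, sending an algebra on `F : 𝒜 ⥤ ℬ` to `ℬ`. -/
def algCod : RAlg.{u} ⥤ Cat.{u, u} :=
  Monad.forget rightMonad ⋙ Arrow.rightFunc

end ElementaryFib

/-! An algebra is a functor `F : 𝒜 ⥤ ℬ` with a strictly functorial choice of transport along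
isomorphisms of `ℬ`, and a morphism of algebras is a square that preserves it strictly. Applied to
functors in place of objects, this means that `U : 𝒟 ⥤ 𝒜` can be transported along any `K ≅ U ⋙ F`
to a functor lying strictly over `K`; the unit and associativity laws become
`AlgStr.transport_of_eq` and `AlgStr.transport_transport`.

Limits of algebras are computed in `Cat`: on a pullback, or on a product over a fixed base, the
structure is forced componentwise (`JointPullback.exists_algStr`, `JointPullback.jointlyCartesian`).
Cartesian lifts and fibred products are therefore two instances of one construction, the jointly
cartesian family.

The parametrised diagonal is the graph ⟨1, P⟩ of the projection P to X, and the argument works for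
the graph of any P : W ⟶ X. The cocartesian lift of an algebra F over W goes to `sigmaFunctor F P`,
whose objects are pairs (A, x : X ≅ P(FA)) lying over (FA, X); the lift is A ↦ (A, id). Each (A, x)
is the transport of (A, id) along (id, x). Hence a vertical morphism of algebras out of
`sigmaFunctor F P` is determined by its restriction to F (`eq_sigmaDesc`), and every morphism out of
F over the graph extends by transport (`sigmaDesc_isAlgHom`).

For Beck–Chevalley, the pairs (A, x) are compatible with pulling back F (`sigmaMap_jointPullback`).
For Frobenius, an object C over (F'A, X) can be transported along the inverse of (id, x) to an
object over (F'A, P(F'A)), so pairing C with (A, x) amounts to giving x and a pair over the graph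
(`sigma_pullbackPair`). Uniqueness of cocartesian and jointly cartesian lifts passes these facts to
the canonical maps of arbitrary left adjoints (`isIso_beckChevalleyMap`, `isIso_frobeniusMap`). -/

namespace ElementaryFib

open CategoryTheory CategoryTheory.Limits CategoryTheory.Functor MonoidalCategory
  CartesianMonoidalCategory

/-! ### Criteria for a general functor: fibred products, left adjoints, Frobenius and
Beck–Chevalley. -/

section Criterion

variable {E : Type u₂} {B : Type u₁} [Category.{v₂} E] [Category.{v₁} B]

/-- A family of arrows `f i : γ ⟶ α i` over `K i : X ⟶ Y i` is jointly cartesian if arrows into `γ`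
over `g` correspond to families of arrows into the `α i` over the composites `g ≫ K i`. -/
structure JointlyCartesian (p : E ⥤ B) {ι : Type*} {X : B} {Y : ι → B} (K : ∀ i, X ⟶ Y i) {γ : E}
    {α : ι → E} (f : ∀ i, γ ⟶ α i) : Prop where
  obj_eq : p.obj γ = X
  isHomLift : ∀ i, p.IsHomLift (K i) (f i)
  exists_lift : ∀ {V : B} {β : E}, p.obj β = V → ∀ (g : V ⟶ X) (h : ∀ i, β ⟶ α i),
    (∀ i, p.IsHomLift (g ≫ K i) (h i)) → ∃ k : β ⟶ γ, p.IsHomLift g k ∧ ∀ i, k ≫ f i = h i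
  hom_ext : ∀ {V : B} {β : E} (g : V ⟶ X) (k k' : β ⟶ γ), p.IsHomLift g k → p.IsHomLift g k' →
    (∀ i, k ≫ f i = k' ≫ f i) → k = k'

namespace JointlyCartesian

variable {p : E ⥤ B} {ι : Type*} {X : B} {Y : ι → B} {K : ∀ i, X ⟶ Y i} {γ : E} {α : ι → E}
  {f : ∀ i, γ ⟶ α i}

/-- A single arrow which is jointly cartesian is strongly cartesian. -/
lemma isStronglyCartesian {X Y : B} {K : X ⟶ Y} {γ α : E} {f : γ ⟶ α}
    (h : JointlyCartesian p (fun _ : Unit => K) (fun _ => f)) : p.IsStronglyCartesian K f where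
  toIsHomLift := h.isHomLift ()
  universal_property' {β} g φ hφ := by
    obtain ⟨k, hk, hk'⟩ := h.exists_lift rfl g (fun _ => φ) (fun _ => hφ)
    exact ⟨k, ⟨hk, hk' ()⟩, fun k' hk'' =>
      h.hom_ext g _ _ hk''.1 hk fun i => hk''.2.trans (hk' i).symm⟩

/-- Jointly cartesian families are invariant under vertical isomorphisms. -/
lemma of_iso (h : JointlyCartesian p K f) {γ' : E} {α' : ι → E} (e : γ' ≅ γ)
    (he : p.IsHomLift (𝟙 X) e.hom) (s : ∀ i, α i ≅ α' i) (hs : ∀ i, p.IsHomLift (𝟙 (Y i)) (s i).hom)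
    {f' : ∀ i, γ' ⟶ α' i} (hf' : ∀ i, f' i = e.hom ≫ f i ≫ (s i).hom) :
    JointlyCartesian p K f' where
  obj_eq := IsHomLift.domain_eq p (𝟙 X) e.hom
  isHomLift i := by
    have := h.isHomLift i
    have := hs i
    rw [hf']
    infer_instance
  exists_lift {V β} hβ g t ht := by
    obtain ⟨k, hk, hk'⟩ := h.exists_lift hβ g (fun i => t i ≫ (s i).inv) fun i => by
      have := ht i
      have := hs i
      infer_instance
    refine ⟨k ≫ e.inv, inferInstance, fun i => ?_⟩
    simp [hf', reassoc_of% hk']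
  hom_ext {V β} g k k' hk hk' e' := by
    rw [← cancel_mono e.hom]
    refine h.hom_ext g _ _ inferInstance inferInstance fun i => ?_
    have := e' i
    rw [hf'] at this
    rw [← cancel_mono (s i).hom]
    simpa using this

/-- A jointly cartesian family over identities is a product in the fibre. -/
lemma isLimit {X : B} {γ : Fiber p X} {α : ι → Fiber p X} {f : ∀ i, γ ⟶ α i}
    (h : JointlyCartesian p (fun _ : ι => 𝟙 X) (fun i => (f i).1)) :
    Nonempty (IsLimit (Fan.mk γ f)) := by
  choose k hk hk' using fun (β : Fiber p X) (t : ∀ i, β ⟶ α i) =>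
    h.exists_lift β.2 (𝟙 X) (fun i => (t i).1) fun i => inferInstance
  refine ⟨Fan.IsLimit.mk _ (fun s => ⟨k s.pt s.proj, hk _ _⟩) (fun s i => Subtype.ext ?_)
    (fun s m hm => Subtype.ext ?_)⟩
  · exact hk' _ _ i
  · refine h.hom_ext (𝟙 X) _ _ m.2 (hk _ _) fun i => ?_
    exact (congrArg Subtype.val (hm i)).trans (hk' _ _ i).symm

end JointlyCartesian

variable {p : E ⥤ B}

/-- A functor with enough jointly cartesian families is a fibration. -/
lemma isFibered_of_jointlyCartesian
    (h : ∀ {X Y : B} (K : X ⟶ Y) (α : E), p.obj α = Y →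
      ∃ (γ : E) (f : γ ⟶ α), JointlyCartesian p (fun _ : Unit => K) (fun _ => f)) :
    p.IsFibered :=
  IsFibered.of_exists_isStronglyCartesian fun α _ K => by
    obtain ⟨γ, f, hf⟩ := h K α rfl
    exact ⟨γ, f, hf.isStronglyCartesian⟩

/-- Two cocartesian arrows with vertically isomorphic sources have vertically isomorphic
targets. -/
lemma exists_iso_of_isCocartesian {W Z : B} (d : W ⟶ Z) {A A' C C' : E} (e : A ≅ A')
    (he : p.IsHomLift (𝟙 W) e.hom) (i : A ⟶ C) (i' : A' ⟶ C') (hi : p.IsCocartesian d i)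
    (hi' : p.IsCocartesian d i') :
    ∃ s : C ≅ C', p.IsHomLift (𝟙 Z) s.hom ∧ i ≫ s.hom = e.hom ≫ i' := by
  refine ⟨⟨IsCocartesian.map p d i (e.hom ≫ i'), IsCocartesian.map p d i' (e.inv ≫ i), ?_, ?_⟩,
    inferInstance, IsCocartesian.fac p d i _⟩
  · have := IsHomLift.id (IsHomLift.codomain_eq p d i)
    refine IsCocartesian.ext p d i _ _ ?_
    rw [IsCocartesian.fac_assoc, Category.assoc, IsCocartesian.fac]
    simp
  · have := IsHomLift.id (IsHomLift.codomain_eq p d i')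
    refine IsCocartesian.ext p d i' _ _ ?_
    rw [IsCocartesian.fac_assoc, Category.assoc, IsCocartesian.fac]
    simp

/-- The dependent function on `Bool` with the given values. -/
abbrev boolPair {C : Bool → Sort*} (a : C true) (b : C false) : ∀ i, C i
  | true => a
  | false => b

/-- A jointly cartesian pair of arrows `f₁ : γ ⟶ α₁` and `f₂ : γ ⟶ α₂`. -/
abbrev JointlyCartesianPair (p : E ⥤ B) {X Y₁ Y₂ : B} (K₁ : X ⟶ Y₁) (K₂ : X ⟶ Y₂) {γ α₁ α₂ : E}
    (f₁ : γ ⟶ α₁) (f₂ : γ ⟶ α₂) : Prop :=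
  JointlyCartesian p (ι := Bool) (Y := boolPair (C := fun _ => B) Y₁ Y₂)
    (α := boolPair (C := fun _ => E) α₁ α₂)
    (boolPair (C := fun i => X ⟶ boolPair (C := fun _ => B) Y₁ Y₂ i) K₁ K₂)
    (boolPair (C := fun i => γ ⟶ boolPair (C := fun _ => E) α₁ α₂ i) f₁ f₂)

namespace JointlyCartesianPair

variable {X Y₁ Y₂ : B} {K₁ : X ⟶ Y₁} {K₂ : X ⟶ Y₂} {γ α₁ α₂ : E} {f₁ : γ ⟶ α₁} {f₂ : γ ⟶ α₂}

lemma exists_lift (h : JointlyCartesianPair p K₁ K₂ f₁ f₂) {V : B} {β : E} (hβ : p.obj β = V)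
    (g : V ⟶ X) (h₁ : β ⟶ α₁) (h₂ : β ⟶ α₂) (hh₁ : p.IsHomLift (g ≫ K₁) h₁)
    (hh₂ : p.IsHomLift (g ≫ K₂) h₂) :
    ∃ k : β ⟶ γ, p.IsHomLift g k ∧ k ≫ f₁ = h₁ ∧ k ≫ f₂ = h₂ := by
  obtain ⟨k, hk, hk'⟩ := JointlyCartesian.exists_lift h hβ g
    (boolPair (C := fun i => β ⟶ boolPair (C := fun _ => E) α₁ α₂ i) h₁ h₂)
    (by rintro (_ | _); exacts [hh₂, hh₁])
  exact ⟨k, hk, hk' true, hk' false⟩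

lemma hom_ext (h : JointlyCartesianPair p K₁ K₂ f₁ f₂) {V : B} {β : E} (g : V ⟶ X) (k k' : β ⟶ γ)
    (hk : p.IsHomLift g k) (hk' : p.IsHomLift g k') (h₁ : k ≫ f₁ = k' ≫ f₁)
    (h₂ : k ≫ f₂ = k' ≫ f₂) : k = k' :=
  JointlyCartesian.hom_ext h g k k' hk hk' (by rintro (_ | _); exacts [h₂, h₁])

/-- A jointly cartesian pair over identities is a binary product in the fibre. -/
lemma isLimit {X : B} {γ α₁ α₂ : Fiber p X} {f₁ : γ ⟶ α₁} {f₂ : γ ⟶ α₂}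
    (h : JointlyCartesianPair p (𝟙 X) (𝟙 X) f₁.1 f₂.1) :
    Nonempty (IsLimit (BinaryFan.mk f₁ f₂)) := by
  choose k hk hk₁ hk₂ using fun (β : Fiber p X) (t₁ : β ⟶ α₁) (t₂ : β ⟶ α₂) =>
    JointlyCartesianPair.exists_lift h β.2 (𝟙 X) t₁.1 t₂.1 inferInstance inferInstance
  refine ⟨BinaryFan.isLimitMk (fun s => ⟨k s.pt s.fst s.snd, hk _ _ _⟩)
    (fun s => Subtype.ext (hk₁ _ _ _)) (fun s => Subtype.ext (hk₂ _ _ _))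
    (fun s m hm₁ hm₂ => Subtype.ext ?_)⟩
  refine JointlyCartesianPair.hom_ext h (𝟙 X) _ _ m.2 (hk _ _ _) ?_ ?_
  · exact (congrArg Subtype.val hm₁).trans (hk₁ _ _ _).symm
  · exact (congrArg Subtype.val hm₂).trans (hk₂ _ _ _).symm

end JointlyCartesianPair

lemma Fiber.isIso_of_isIso_val {X : B} {A A' : Fiber p X} (g : A ⟶ A') [IsIso g.1] : IsIso g :=
  ⟨⟨inv g.1, inferInstance⟩, Subtype.ext (IsIso.hom_inv_id g.1), Subtype.ext (IsIso.inv_hom_id g.1)⟩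

variable [p.IsFibered]

lemma reindex_map_fac {X Y : B} (f : X ⟶ Y) {A A' : Fiber p Y} (g : A ⟶ A') :
    ((reindex p f).map g).1 ≫ cartLift p f A' = cartLift p f A ≫ g.1 :=
  IsCartesian.fac p f (IsPreFibered.pullbackMap A'.2 f) (IsPreFibered.pullbackMap A.2 f ≫ g.1)

/-- Vertical arrows into a reindexed object are determined by their composite with the cartesian
lift. -/
lemma reindex_hom_ext {X Y : B} (f : X ⟶ Y) {A : Fiber p X} {A' : Fiber p Y}
    {g g' : A ⟶ (reindex p f).obj A'} (h : g.1 ≫ cartLift p f A' = g'.1 ≫ cartLift p f A') :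
    g = g' :=
  Subtype.ext (IsCartesian.ext p f (cartLift p f A') g.1 g'.1 h)

/-- A family over `g` into the reindexed objects becomes, after composing with the cartesian lifts,
a family over `g ≫ t` into the `α i`. It factors through `γ`, and the factorisation then lifts
through the cartesian arrow to `γ`. This is why reindexing preserves the products. -/
lemma JointlyCartesian.reindex {ι : Type*} {X Y : B} (t : X ⟶ Y) {γ : Fiber p Y}
    {α : ι → Fiber p Y} {f : ∀ i, γ ⟶ α i}
    (h : JointlyCartesian p (fun _ : ι => 𝟙 Y) (fun i => (f i).1)) :
    JointlyCartesian p (fun _ : ι => 𝟙 X) (fun i => ((reindex p t).map (f i)).1) where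
  obj_eq := ((ElementaryFib.reindex p t).obj γ).2
  isHomLift _ := inferInstance
  exists_lift {V β} hβ g k hk := by
    obtain ⟨l, hl, hl'⟩ := h.exists_lift hβ (g ≫ t) (fun i => k i ≫ cartLift p t (α i)) fun i => by
      have := hk i
      rw [Category.comp_id] at this ⊢
      infer_instance
    refine ⟨IsStronglyCartesian.map p t (cartLift p t γ) rfl l,
      IsStronglyCartesian.map_isHomLift p t (cartLift p t γ) rfl l, fun i => ?_⟩
    have := hk i
    rw [Category.comp_id] at this
    refine IsStronglyCartesian.ext p t (cartLift p t (α i)) g ?_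
    rw [Category.assoc, reindex_map_fac, IsStronglyCartesian.fac_assoc, hl']
  hom_ext {V β} g k k' hk hk' e := by
    refine IsStronglyCartesian.ext p t (cartLift p t γ) g ?_
    refine h.hom_ext (g ≫ t) _ _ inferInstance inferInstance fun i => ?_
    rw [Category.assoc, Category.assoc, ← reindex_map_fac, reassoc_of% e i]

/-- Since `n` may be zero, the hypothesis also covers the terminal objects. Preservation needs
checking on one product cone only, and the cone built here stays jointly cartesian after reindexing.
-/
lemma hasFibredProducts_of_jointlyCartesian [CartesianMonoidalCategory B]
    (h : ∀ (n : ℕ) (X : B) (α : Fin n → E), (∀ i, p.obj (α i) = X) →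
      ∃ (γ : E) (f : ∀ i, γ ⟶ α i), JointlyCartesian p (fun _ => 𝟙 X) f) :
    HasFibredProducts p := by
  have key : ∀ (n : ℕ) (X : B) (α : Fin n → Fiber p X), ∃ (γ : Fiber p X) (f : ∀ i, γ ⟶ α i),
      JointlyCartesian p (fun _ => 𝟙 X) (fun i => (f i).1) := fun n X α => by
    obtain ⟨γ, f, hf⟩ := h n X (fun i => (α i).1) (fun i => (α i).2)
    exact ⟨⟨γ, hf.obj_eq⟩, fun i => ⟨f i, hf.isHomLift i⟩, hf⟩
  refine ⟨fun X => ?_, fun {X Y} t => ⟨fun n => ?_⟩⟩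
  · refine ⟨fun n => ?_⟩
    have : ∀ α : Fin n → Fiber p X, HasProduct α := fun α => by
      obtain ⟨γ, f, hf⟩ := key n X α
      exact ⟨_, hf.isLimit.some⟩
    exact ⟨fun _ => hasLimit_of_iso Discrete.natIsoFunctor.symm⟩
  · have : ∀ α : Fin n → Fiber p Y, PreservesLimit (Discrete.functor α) (reindex p t) := fun α => by
      obtain ⟨γ, f, hf⟩ := key n Y α
      exact preservesLimit_of_preserves_limit_cone hf.isLimit.some
        ((isLimitMapConeFanMkEquiv _ _ _).symm (hf.reindex t).isLimit.some)
    exact preservesLimitsOfShape_of_discrete _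

section LeftAdjoint

variable {W Z : B} {d : W ⟶ Z}

/-- Cocartesian lifts of `d` provide a left adjoint to reindexing along `d`. -/
lemma exists_leftAdjoint
    (h : ∀ A : Fiber p W, ∃ (A' : E) (i : A.1 ⟶ A'), p.IsCocartesian d i) :
    ∃ L : Fiber p W ⥤ Fiber p Z, Nonempty (L ⊣ reindex p d) := by
  choose T i hi using h
  let T' : Fiber p W → Fiber p Z := fun A => ⟨T A, IsHomLift.codomain_eq p d (i A)⟩
  let e : ∀ (A : Fiber p W) (C : Fiber p Z), (T' A ⟶ C) ≃ (A ⟶ (reindex p d).obj C) :=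
    fun A C =>
    { toFun g :=
        haveI : p.IsHomLift (𝟙 Z) g.1 := g.2
        ⟨IsCartesian.map p d (cartLift p d C) (i A ≫ g.1), inferInstance⟩
      invFun g := ⟨IsCocartesian.map p d (i A) (g.1 ≫ cartLift p d C), inferInstance⟩
      left_inv g := by
        have : p.IsHomLift (𝟙 Z) g.1 := g.2
        refine Subtype.ext (IsCocartesian.map_uniq p d (i A) _ g.1 ?_).symm
        exact (IsCartesian.fac p d (cartLift p d C) (i A ≫ g.1)).symm
      right_inv g := by
        refine Subtype.ext (IsCartesian.map_uniq p d (cartLift p d C) _ g.1 ?_).symm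
        exact (IsCocartesian.fac p d (i A) (g.1 ≫ cartLift p d C)).symm }
  have he : ∀ A C C' g h, e A C' (h ≫ g) = e A C h ≫ (reindex p d).map g := fun A C C' g h => by
    have : p.IsHomLift (𝟙 Z) h.1 := h.2
    refine reindex_hom_ext d ?_
    have h1 : (e A C' (h ≫ g)).1 ≫ cartLift p d C' = i A ≫ (h ≫ g).1 :=
      haveI : p.IsHomLift (𝟙 Z) (h ≫ g).1 := (h ≫ g).2
      IsCartesian.fac p d (cartLift p d C') _
    have h2 : (e A C h).1 ≫ cartLift p d C = i A ≫ h.1 := IsCartesian.fac p d (cartLift p d C) _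
    change _ = ((e A C h).1 ≫ ((reindex p d).map g).1) ≫ _
    rw [h1, Category.assoc, reindex_map_fac, reassoc_of% h2]
    rfl
  exact ⟨_, ⟨Adjunction.adjunctionOfEquivLeft e he⟩⟩

variable {L : Fiber p W ⥤ Fiber p Z} (adj : L ⊣ reindex p d)

/-- The arrow `A ⟶ L A` over `d` corresponding to the unit of an adjunction `L ⊣ d^*`. -/
noncomputable def unitLift (A : Fiber p W) : A.1 ⟶ (L.obj A).1 :=
  (adj.unit.app A).1 ≫ cartLift p d (L.obj A)

instance unitLift_isHomLift (A : Fiber p W) : p.IsHomLift d (unitLift adj A) :=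
  inferInstanceAs (p.IsHomLift d ((adj.unit.app A).1 ≫ cartLift p d (L.obj A)))

lemma homEquiv_fac {A : Fiber p W} {C : Fiber p Z} (g : L.obj A ⟶ C) :
    (adj.homEquiv A C g).1 ≫ cartLift p d C = unitLift adj A ≫ g.1 := by
  rw [adj.homEquiv_unit]
  change ((adj.unit.app A).1 ≫ ((reindex p d).map g).1) ≫ _ = _
  rw [Category.assoc, reindex_map_fac, unitLift, Category.assoc]

lemma unitLift_homEquiv_symm {A : Fiber p W} {C : Fiber p Z} (g : A ⟶ (reindex p d).obj C) :
    unitLift adj A ≫ ((adj.homEquiv A C).symm g).1 = g.1 ≫ cartLift p d C := by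
  rw [← homEquiv_fac, Equiv.apply_symm_apply]

lemma unitLift_map {A A' : Fiber p W} (g : A ⟶ A') :
    unitLift adj A ≫ (L.map g).1 = g.1 ≫ unitLift adj A' := by
  have := congrArg Subtype.val (adj.unit.naturality g)
  change g.1 ≫ (adj.unit.app A').1 = (adj.unit.app A).1 ≫ ((reindex p d).map (L.map g)).1 at this
  rw [unitLift, unitLift, Category.assoc, ← reindex_map_fac, reassoc_of% this]

/-- Converse to `exists_leftAdjoint`. It allows an arbitrary left adjoint to be compared with any
convenient choice of cocartesian arrows. -/
instance unitLift_isCocartesian (A : Fiber p W) : p.IsCocartesian d (unitLift adj A) where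
  universal_property {C} φ hφ := by
    let C' : Fiber p Z := ⟨C, IsHomLift.codomain_eq p d φ⟩
    let g : A ⟶ (reindex p d).obj C' := ⟨IsCartesian.map p d (cartLift p d C') φ, inferInstance⟩
    refine ⟨((adj.homEquiv A C').symm g).1, ⟨((adj.homEquiv A C').symm g).2, ?_⟩, ?_⟩
    · exact (unitLift_homEquiv_symm adj g).trans (IsCartesian.fac p d (cartLift p d C') φ)
    · rintro k ⟨hk, hk'⟩
      let k' : L.obj A ⟶ C' := ⟨k, hk⟩
      have : k' = (adj.homEquiv A C').symm g := by
        rw [Equiv.eq_symm_apply]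
        refine reindex_hom_ext d ?_
        rw [homEquiv_fac]
        exact hk'.trans (IsCartesian.fac p d (cartLift p d C') φ).symm
      exact congrArg Subtype.val this

end LeftAdjoint

/-- In a fibration, arrows out of the target of a cocartesian arrow over `d` which lie over any
`v` are determined by their precomposite with the cocartesian arrow. -/
lemma IsCocartesian.hom_ext_of_isFibered {W Z Z' : B} (d : W ⟶ Z) {A C D : E} (i : A ⟶ C)
    [p.IsCocartesian d i] (v : Z ⟶ Z') (k k' : C ⟶ D) [p.IsHomLift v k] [p.IsHomLift v k']
    (h : i ≫ k = i ≫ k') : k = k' := by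
  let D' : Fiber p Z' := ⟨D, IsHomLift.codomain_eq p v k⟩
  have e : p.IsCartesian v (cartLift p v D') := inferInstance
  -- Factoring both arrows through the cartesian lift of `v` makes them vertical, where the
  -- universal property of the cocartesian arrow applies.
  have h1 : IsCartesian.map p v (cartLift p v D') k = IsCartesian.map p v (cartLift p v D') k' := by
    refine IsCocartesian.ext p d i _ _ ?_
    refine IsStronglyCartesian.ext p v (cartLift p v D') d ?_
    have e1 := IsCartesian.fac p v (cartLift p v D') k
    have e2 := IsCartesian.fac p v (cartLift p v D') k'
    rw [Category.assoc, Category.assoc]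
    exact (congrArg (i ≫ ·) e1).trans (h.trans (congrArg (i ≫ ·) e2).symm)
  exact (IsCartesian.fac p v (cartLift p v D') k).symm.trans
    ((congrArg (· ≫ cartLift p v D') h1).trans (IsCartesian.fac p v (cartLift p v D') k'))

namespace JointlyCartesianPair

/-- A jointly cartesian pair over `d` and an identity is a product of a reindexed object with
another one. -/
lemma isLimit_reindex {W Z : B} {d : W ⟶ Z} {Q A : Fiber p W} {C : Fiber p Z} {q₁ : Q.1 ⟶ C.1}
    {q₂ : Q ⟶ A} (h : JointlyCartesianPair p d (𝟙 W) q₁ q₂.1)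
    {q : Q ⟶ (reindex p d).obj C} (hq : q.1 ≫ cartLift p d C = q₁) :
    Nonempty (IsLimit (BinaryFan.mk q q₂)) := by
  choose k hk hk₁ hk₂ using fun (β : Fiber p W) (t₁ : β ⟶ (reindex p d).obj C) (t₂ : β ⟶ A) =>
    JointlyCartesianPair.exists_lift h β.2 (𝟙 W) (t₁.1 ≫ cartLift p d C) t₂.1 inferInstance
      inferInstance
  refine ⟨BinaryFan.isLimitMk (fun s => ⟨k s.pt s.fst s.snd, hk _ _ _⟩)
    (fun s => reindex_hom_ext d ?_) (fun s => Subtype.ext (hk₂ _ _ _))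
    (fun s m hm₁ hm₂ => Subtype.ext ?_)⟩
  · change (k s.pt s.fst s.snd ≫ q.1) ≫ _ = _
    exact (Category.assoc _ _ _).trans ((congrArg (_ ≫ ·) hq).trans (hk₁ _ _ _))
  · refine JointlyCartesianPair.hom_ext h (𝟙 W) _ _ m.2 (hk _ _ _) ?_ ?_
    · refine Eq.trans ?_ (hk₁ _ _ _).symm
      exact (congrArg (m.1 ≫ ·) hq.symm).trans ((Category.assoc _ _ _).symm.trans
        (congrArg (·.1 ≫ cartLift p d C) hm₁))
    · exact (congrArg Subtype.val hm₂).trans (hk₂ _ _ _).symm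

end JointlyCartesianPair

/-- The Beck-Chevalley map is invertible if cocartesian lifts can be chosen such that the induced
arrow between their targets is cartesian. -/
lemma isIso_beckChevalleyMap {W W' Z Z' : B} {u : W ⟶ W'} {d : W ⟶ Z} {d' : W' ⟶ Z'} {v : Z ⟶ Z'}
    (h : u ≫ d' = d ≫ v) {L : Fiber p W ⥤ Fiber p Z} {L' : Fiber p W' ⥤ Fiber p Z'}
    (adj : L ⊣ reindex p d) (adj' : L' ⊣ reindex p d') (A : Fiber p W')
    {A' C C' : E} {c : A' ⟶ A.1} {i : A.1 ⟶ C} {i' : A' ⟶ C'} {k : C' ⟶ C}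
    (hc : p.IsCartesian u c) (hi : p.IsCocartesian d' i) (hi' : p.IsCocartesian d i')
    (hk : JointlyCartesian p (fun _ : Unit => v) (fun _ => k)) (w : i' ≫ k = c ≫ i) :
    IsIso (beckChevalleyMap p h adj adj' A) := by
  set b := beckChevalleyMap p h adj adj' A with hb
  have fac : unitLift adj ((reindex p u).obj A) ≫ b.1 ≫ cartLift p v (L'.obj A) =
      cartLift p u A ≫ unitLift adj' A := by
    have h1 := unitLift_homEquiv_symm adj
      ((reindex p u).map (adj'.unit.app A) ≫ reindexSquare p h (L'.obj A))
    have h2 := reindexSquare_fac p h (L'.obj A)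
    have h3 := reindex_map_fac (p := p) u (adj'.unit.app A)
    rw [hb, beckChevalleyMap, reassoc_of% h1]
    change (((reindex p u).map (adj'.unit.app A)).1 ≫ (reindexSquare p h (L'.obj A)).1) ≫ _ = _
    rw [Category.assoc, h2, reassoc_of% h3]
    rfl
  let e := IsCartesian.domainUniqueUpToIso p u c (cartLift p u A)
  have he : e.hom ≫ c = cartLift p u A := IsCartesian.fac p u c (cartLift p u A)
  obtain ⟨s, hs, hs'⟩ := exists_iso_of_isCocartesian (p := p) d' (Iso.refl A.1)
    (IsHomLift.id A.2) i (unitLift adj' A) hi inferInstance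
  obtain ⟨r, hr, hr'⟩ := exists_iso_of_isCocartesian (p := p) d e inferInstance
    (unitLift adj ((reindex p u).obj A)) i' inferInstance hi'
  have := hk.isHomLift ()
  -- Up to the vertical isomorphisms `r` and `s`, the comparison followed by the cartesian lift is
  -- the given cartesian arrow `k`. Cancelling the lift makes `b` itself cartesian over an identity,
  -- hence invertible.
  have key : b.1 ≫ cartLift p v (L'.obj A) = r.hom ≫ k ≫ s.hom := by
    refine IsCocartesian.hom_ext_of_isFibered (p := p) d
      (unitLift adj ((reindex p u).obj A)) v _ _ ?_
    rw [fac, reassoc_of% hr', reassoc_of% w, hs', ← he]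
    simp
  have hcart := (hk.of_iso r hr (fun _ => s) (fun _ => hs) (fun _ => key)).isStronglyCartesian
  have : p.IsStronglyCartesian (𝟙 Z ≫ v) (b.1 ≫ cartLift p v (L'.obj A)) := by
    rwa [Category.id_comp]
  have : p.IsStronglyCartesian (𝟙 Z) b.1 :=
    IsStronglyCartesian.of_comp p (g := v) (ψ := cartLift p v (L'.obj A))
  have := IsStronglyCartesian.isIso_of_base_isIso p (𝟙 Z) b.1
  exact Fiber.isIso_of_isIso_val b

/-- The Frobenius map is invertible if cocartesian lifts can be chosen such that the target of the
one starting at `d^* C ∧ A` is a product. -/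
lemma isIso_frobeniusMap {W Z : B} [HasFiniteProducts (Fiber p W)] [HasFiniteProducts (Fiber p Z)]
    {d : W ⟶ Z} {L : Fiber p W ⥤ Fiber p Z} (adj : L ⊣ reindex p d) (A : Fiber p W)
    (C : Fiber p Z) {Q S T : E} {q₁ : Q ⟶ C.1} {q₂ : Q ⟶ A.1} {i : A.1 ⟶ S} {j : Q ⟶ T}
    {t₁ : T ⟶ C.1} {t₂ : T ⟶ S} (hq : JointlyCartesianPair p d (𝟙 W) q₁ q₂)
    (hi : p.IsCocartesian d i) (hj : p.IsCocartesian d j)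
    (ht : JointlyCartesianPair p (𝟙 Z) (𝟙 Z) t₁ t₂) (w₁ : j ≫ t₁ = q₁) (w₂ : j ≫ t₂ = q₂ ≫ i) :
    IsIso (frobeniusMap p adj A C) := by
  have hq₁ : p.IsHomLift d q₁ := hq.isHomLift true
  have hq₂ : p.IsHomLift (𝟙 W) q₂ := hq.isHomLift false
  have ht₁ : p.IsHomLift (𝟙 Z) t₁ := ht.isHomLift true
  have ht₂ : p.IsHomLift (𝟙 Z) t₂ := ht.isHomLift false
  let Q' : Fiber p W := ⟨Q, hq.obj_eq⟩
  let q : Q' ⟶ (reindex p d).obj C := ⟨IsCartesian.map p d (cartLift p d C) q₁, inferInstance⟩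
  have hqfac : q.1 ≫ cartLift p d C = q₁ := IsCartesian.fac p d (cartLift p d C) q₁
  let q₂' : Q' ⟶ A := ⟨q₂, hq₂⟩
  obtain ⟨hlim⟩ := JointlyCartesianPair.isLimit_reindex (Q := Q') (q₂ := q₂') hq hqfac
  let e : (reindex p d).obj C ⨯ A ≅ Q' :=
    IsLimit.conePointUniqueUpToIso (prodIsProd ((reindex p d).obj C) A) hlim
  have he₁ : e.hom ≫ q = prod.fst :=
    IsLimit.conePointUniqueUpToIso_hom_comp (prodIsProd _ _) hlim ⟨WalkingPair.left⟩
  have he₂ : e.hom ≫ q₂' = prod.snd :=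
    IsLimit.conePointUniqueUpToIso_hom_comp (prodIsProd _ _) hlim ⟨WalkingPair.right⟩
  have he₁' : e.hom.1 ≫ q₁ = (prod.fst : (reindex p d).obj C ⨯ A ⟶ _).1 ≫ cartLift p d C := by
    rw [← he₁, ← hqfac]
    exact (Category.assoc _ _ _).symm
  have he₂' : e.hom.1 ≫ q₂ = (prod.snd : (reindex p d).obj C ⨯ A ⟶ _).1 := by
    rw [← he₂]
    rfl
  obtain ⟨s, hs, hs'⟩ := exists_iso_of_isCocartesian (p := p) d (Iso.refl A.1)
    (IsHomLift.id A.2) i (unitLift adj A) hi inferInstance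
  obtain ⟨r, hr, hr'⟩ := exists_iso_of_isCocartesian (p := p) d
    (Fiber.fiberInclusion.mapIso e) e.hom.2 (unitLift adj ((reindex p d).obj C ⨯ A)) j
    (unitLift_isCocartesian adj ((reindex p d).obj C ⨯ A)) hj
  replace hr' : unitLift adj ((reindex p d).obj C ⨯ A) ≫ r.hom = e.hom.1 ≫ j := hr'
  replace hs' : i ≫ s.hom = unitLift adj A := hs'.trans (Category.id_comp _)
  have k₁ : ((adj.homEquiv ((reindex p d).obj C ⨯ A) C).symm prod.fst).1 = r.hom ≫ t₁ ≫ 𝟙 _ := by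
    rw [Category.comp_id]
    refine IsCocartesian.ext p d (unitLift adj ((reindex p d).obj C ⨯ A)) _ _ ?_
    rw [unitLift_homEquiv_symm, reassoc_of% hr', w₁, he₁']
  have k₂ : (L.map (prod.snd : (reindex p d).obj C ⨯ A ⟶ A)).1 = r.hom ≫ t₂ ≫ s.hom := by
    refine IsCocartesian.ext p d (unitLift adj ((reindex p d).obj C ⨯ A)) _ _ ?_
    rw [unitLift_map, reassoc_of% hr', reassoc_of% w₂, hs', ← he₂', Category.assoc]
  have hpair : JointlyCartesianPair p (𝟙 Z) (𝟙 Z)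
      ((adj.homEquiv ((reindex p d).obj C ⨯ A) C).symm prod.fst).1
      (L.map (prod.snd : (reindex p d).obj C ⨯ A ⟶ A)).1 :=
    JointlyCartesian.of_iso ht r hr
      (boolPair (C := fun i => boolPair (C := fun _ => E) C.1 S i ≅
        boolPair (C := fun _ => E) C.1 (L.obj A).1 i) (Iso.refl _) s)
      (by rintro (_ | _); exacts [hs, IsHomLift.id C.2]) (by rintro (_ | _); exacts [k₂, k₁])
  obtain ⟨hlim'⟩ := JointlyCartesianPair.isLimit hpair
  -- The two components of the Frobenius map form a product cone, so the map is the comparison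
  -- between two products of the same objects.
  have : frobeniusMap p adj A C =
      (IsLimit.conePointUniqueUpToIso hlim' (prodIsProd C (L.obj A))).hom := by
    refine Limits.prod.hom_ext ?_ ?_
    · rw [frobeniusMap, prod.lift_fst]
      exact (IsLimit.conePointUniqueUpToIso_hom_comp hlim' (prodIsProd _ _)
        ⟨WalkingPair.left⟩).symm
    · rw [frobeniusMap, prod.lift_snd]
      exact (IsLimit.conePointUniqueUpToIso_hom_comp hlim' (prodIsProd _ _)
        ⟨WalkingPair.right⟩).symm
  rw [this]
  infer_instance

end Criterion

/-! ### Bookkeeping for strict equalities between objects and functors. -/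

section EqToHom

variable {𝒜 : Type u₁} [Category.{v₁} 𝒜]

lemma eqToHom_comp_id_comp_id {X Y : 𝒜} (h : X = Y) : eqToHom h ≫ 𝟙 Y ≫ 𝟙 Y = eqToHom h := by
  simp

lemma comp_eqToHom_comp_eqToHom {X Y Z : 𝒜} (f : X ⟶ Y) (h : Y = Z) (h' : Z = Y) :
    (f ≫ eqToHom h) ≫ eqToHom h' = f := by
  simp

lemma comp_eqToHom_comp_eqToHom_comp {X Y Z W : 𝒜} (f : X ⟶ Y) (h : Y = Z) (h' : Z = Y)
    (g : Y ⟶ W) : (f ≫ eqToHom h) ≫ eqToHom h' ≫ g = f ≫ g := by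
  simp

/-- The isomorphism between equal functors, with `eqToIso` as components. -/
def eqIso {ℬ : Type u₂} [Category.{v₂} ℬ] {F G : 𝒜 ⥤ ℬ} (h : F = G) : F ≅ G :=
  NatIso.ofComponents (fun X => eqToIso (Functor.congr_obj h X)) fun f => by
    subst h
    simp

end EqToHom

/-! ### Algebra structures as strict transport of functors along isomorphisms. -/

section AlgebraStructures

variable {𝒜 ℬ : Type u} [Category.{u} 𝒜] [Category.{u} ℬ] {𝒞 𝒟 : Type u} [Category.{u} 𝒞]
  [Category.{u} 𝒟]

/-- The functor into `M F` given by its two projections and an isomorphism. -/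
def liftM {F : 𝒜 ⥤ ℬ} (U : 𝒟 ⥤ 𝒜) (K : 𝒟 ⥤ ℬ) (α : K ≅ U ⋙ F) : 𝒟 ⥤ MObj F where
  obj d := ⟨U.obj d, K.obj d, α.app d⟩
  map f := ⟨K.map f, U.map f, α.hom.naturality f⟩
  map_id d := MHom.ext (K.map_id d) (U.map_id d)
  map_comp f g := MHom.ext (K.map_comp f g) (U.map_comp f g)

/-- The isomorphism carried by the objects of `M F`. -/
def isoM (F : 𝒜 ⥤ ℬ) : rightFactor F ≅ srcFunctor F ⋙ F :=
  NatIso.ofComponents (fun P => P.iso) fun f => f.w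

lemma liftM_congr {F : 𝒜 ⥤ ℬ} {U U' : 𝒟 ⥤ 𝒜} {K K' : 𝒟 ⥤ ℬ} {α : K ≅ U ⋙ F} {α' : K' ≅ U' ⋙ F}
    (hU : U = U') (hK : K = K')
    (hα : ∀ d, α.hom.app d = eqToHom (Functor.congr_obj hK d) ≫ α'.hom.app d ≫
      eqToHom (congrArg F.obj (Functor.congr_obj hU d).symm)) :
    liftM U K α = liftM U' K' α' :=
  functor_ext_to_M hU hK hα

lemma mapFunctor_congr {F : 𝒜 ⥤ ℬ} {G : 𝒞 ⥤ 𝒟} {H H' : 𝒜 ⥤ 𝒞} {K K' : ℬ ⥤ 𝒟} (hH : H = H')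
    (hK : K = K') (h : F ⋙ K = H ⋙ G) (h' : F ⋙ K' = H' ⋙ G) :
    mapFunctor H K h = mapFunctor H' K' h' := by
  subst hH hK
  rfl

lemma mapFunctor_eq_liftM {F : 𝒜 ⥤ ℬ} {G : 𝒞 ⥤ 𝒟} {H : 𝒜 ⥤ 𝒞} {K : ℬ ⥤ 𝒟} (w : F ⋙ K = H ⋙ G) :
    mapFunctor H K w = liftM (srcFunctor F ⋙ H) (rightFactor F ⋙ K)
      (isoWhiskerRight (isoM F) K ≪≫ isoWhiskerLeft (srcFunctor F) (eqIso w)) := by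
  refine functor_ext_to_M rfl rfl fun d => ?_
  change K.map d.iso.hom ≫ (eqToHom w).app d.src =
    𝟙 _ ≫ (K.map d.iso.hom ≫ eqToHom (Functor.congr_obj w d.src)) ≫ 𝟙 _
  rw [Category.id_comp, Category.comp_id, eqToHom_app]

/-- An algebra structure on the functor `F` for the monad `R`, in terms of functors. -/
structure AlgStr (F : 𝒜 ⥤ ℬ) where
  act : MObj F ⥤ 𝒜
  act_comp : act ⋙ F = rightFactor F
  unit : leftFactor F ⋙ act = 𝟭 𝒜
  assoc : mapFunctor (F := rightFactor F) (G := F) act (𝟭 ℬ) act_comp.symm ⋙ act = mulFunctor F ⋙ act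

/-- A square of functors is a morphism of algebras. -/
def IsAlgHom {F : 𝒜 ⥤ ℬ} {G : 𝒞 ⥤ 𝒟} (S : AlgStr F) (S' : AlgStr G) (H : 𝒜 ⥤ 𝒞) (K : ℬ ⥤ 𝒟) :
    Prop :=
  ∃ h : F ⋙ K = H ⋙ G, mapFunctor H K h ⋙ S'.act = S.act ⋙ H

namespace AlgStr

variable {F : 𝒜 ⥤ ℬ} (S : AlgStr F)

/-- The transport of `U : 𝒟 ⥤ 𝒜` along an isomorphism `K ≅ U ⋙ F`. -/
def transport (U : 𝒟 ⥤ 𝒜) (K : 𝒟 ⥤ ℬ) (α : K ≅ U ⋙ F) : 𝒟 ⥤ 𝒜 :=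
  liftM U K α ⋙ S.act

@[simp]
lemma transport_comp (U : 𝒟 ⥤ 𝒜) (K : 𝒟 ⥤ ℬ) (α : K ≅ U ⋙ F) : S.transport U K α ⋙ F = K :=
  (congrArg (liftM U K α ⋙ ·) S.act_comp :)

lemma transport_congr {U U' : 𝒟 ⥤ 𝒜} {K K' : 𝒟 ⥤ ℬ} {α : K ≅ U ⋙ F} {α' : K' ≅ U' ⋙ F}
    (hU : U = U') (hK : K = K')
    (hα : ∀ d, α.hom.app d = eqToHom (Functor.congr_obj hK d) ≫ α'.hom.app d ≫
      eqToHom (congrArg F.obj (Functor.congr_obj hU d).symm)) :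
    S.transport U K α = S.transport U' K' α' :=
  congrArg (· ⋙ S.act) (liftM_congr hU hK hα)

/-- The unit law: when the isomorphism consists of identities, the functor into `MObj F` factors
through `leftFactor F`. -/
lemma transport_of_eq {U : 𝒟 ⥤ 𝒜} {K : 𝒟 ⥤ ℬ} {α : K ≅ U ⋙ F} (h : K = U ⋙ F)
    (hα : ∀ d, α.hom.app d = eqToHom (Functor.congr_obj h d)) : S.transport U K α = U := by
  have : liftM U K α = U ⋙ leftFactor F := by
    refine functor_ext_to_M rfl h fun d => ?_
    exact (hα d).trans (eqToHom_comp_id_comp_id _).symm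
  rw [transport, this]
  exact congrArg (U ⋙ ·) S.unit

lemma transport_transport (U : 𝒟 ⥤ 𝒜) (K K' : 𝒟 ⥤ ℬ) (α : K ≅ U ⋙ F)
    (β : K' ≅ S.transport U K α ⋙ F) :
    S.transport (S.transport U K α) K' β =
      S.transport U K' (β ≪≫ eqIso (S.transport_comp U K α) ≪≫ α) := by
  -- `T` packages the two successive isomorphisms as one functor into M(RF). Its images under the
  -- two sides of the associativity law are the iterated transport and the transport along the
  -- composite.
  let T : 𝒟 ⥤ MObj (rightFactor F) :=
    liftM (F := rightFactor F) (liftM U K α) K' (β ≪≫ eqIso (S.transport_comp U K α))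
  have h1 : T ⋙ mapFunctor (G := F) S.act (𝟭 ℬ) S.act_comp.symm = liftM (S.transport U K α) K' β := by
    refine functor_ext_to_M rfl rfl fun d => ?_
    change ((β.hom.app d ≫ eqToHom (Functor.congr_obj (S.transport_comp U K α) d)) ≫
      (eqToHom S.act_comp.symm).app ((liftM U K α).obj d)) = 𝟙 _ ≫ β.hom.app d ≫ 𝟙 _
    rw [Category.id_comp, Category.comp_id, eqToHom_app]
    exact comp_eqToHom_comp_eqToHom _ _ _
  have h2 : T ⋙ mulFunctor F = liftM U K' (β ≪≫ eqIso (S.transport_comp U K α) ≪≫ α) := by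
    refine functor_ext_to_M rfl rfl fun d => ?_
    change (β.hom.app d ≫ eqToHom (Functor.congr_obj (S.transport_comp U K α) d)) ≫ α.hom.app d =
      𝟙 _ ≫ (β.hom.app d ≫ eqToHom (Functor.congr_obj (S.transport_comp U K α) d) ≫ α.hom.app d) ≫ 𝟙 _
    simp
  rw [transport, ← h1, transport, ← h2]
  exact (congrArg (T ⋙ ·) S.assoc :)

end AlgStr

namespace IsAlgHom

variable {F : 𝒜 ⥤ ℬ} {G : 𝒞 ⥤ 𝒟} {S : AlgStr F} {S' : AlgStr G} {H : 𝒜 ⥤ 𝒞} {K : ℬ ⥤ 𝒟}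

/-- Morphisms of algebras commute with transport. -/
lemma transport_comp (h : IsAlgHom S S' H K) {𝒯 : Type u} [Category.{u} 𝒯] (U : 𝒯 ⥤ 𝒜) (V : 𝒯 ⥤ ℬ)
    (α : V ≅ U ⋙ F) :
    S.transport U V α ⋙ H =
      S'.transport (U ⋙ H) (V ⋙ K) (isoWhiskerRight α K ≪≫ isoWhiskerLeft U (eqIso h.1)) := by
  obtain ⟨w, h⟩ := h
  exact (congrArg (liftM U V α ⋙ ·) (h.symm.trans (congrArg (· ⋙ S'.act) (mapFunctor_eq_liftM w))) :)

/-- The action of `S` is itself the universal transport, that of `srcFunctor F` along `isoM F`, so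
preservation need only be tested there. -/
lemma of_transport (w : F ⋙ K = H ⋙ G)
    (h : S.act ⋙ H = S'.transport (srcFunctor F ⋙ H) (rightFactor F ⋙ K)
      (isoWhiskerRight (isoM F) K ≪≫ isoWhiskerLeft (srcFunctor F) (eqIso w))) :
    IsAlgHom S S' H K :=
  ⟨w, (congrArg (· ⋙ S'.act) (mapFunctor_eq_liftM w)).trans h.symm⟩

end IsAlgHom

end AlgebraStructures

/-! ### Passage between monad algebras and algebra structures on functors. -/

section Algebras

/-- The monad unit is the identity on codomains, so the unit law fixes the codomain part of the
action. -/
lemma algebra_a_right (α : RAlg.{u}) : α.a.right = 𝟙 α.A.right :=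
  (Category.id_comp _).symm.trans (congrArg CommaMorphism.right α.unit)

/-- The functor underlying an algebra. -/
abbrev under (α : RAlg.{u}) : α.A.left ⥤ α.A.right := α.A.hom.toFunctor

/-- The structure functor of an algebra. -/
def str (α : RAlg.{u}) : AlgStr (under α) where
  act := α.a.left.toFunctor
  act_comp := by
    have h := Arrow.w α.a
    rw [algebra_a_right] at h
    exact congrArg Cat.Hom.toFunctor h
  unit := congrArg (fun f => f.left.toFunctor) α.unit
  assoc := by
    have h : mulFunctor (under α) ⋙ α.a.left.toFunctor =
        mapFunctor α.a.left.toFunctor α.a.right.toFunctor (square_functor α.a) ⋙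
          α.a.left.toFunctor := congrArg (fun f => f.left.toFunctor) α.assoc
    rw [h]
    congr 1
    exact mapFunctor_congr rfl (congrArg Cat.Hom.toFunctor (algebra_a_right α)).symm _ _

lemma hom_w {α β : RAlg.{u}} (f : α ⟶ β) :
    under α ⋙ f.f.right.toFunctor = f.f.left.toFunctor ⋙ under β :=
  square_functor f.f

lemma hom_isAlgHom {α β : RAlg.{u}} (f : α ⟶ β) :
    IsAlgHom (str α) (str β) f.f.left.toFunctor f.f.right.toFunctor :=
  ⟨hom_w f, congrArg (fun f => f.left.toFunctor) f.h⟩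

/-- The algebra given by an algebra structure on a functor. -/
def mkAlg {𝒜 ℬ : Cat.{u, u}} (F : 𝒜 ⥤ ℬ) (S : AlgStr F) : RAlg.{u} where
  A := Arrow.mk F.toCatHom
  a := Arrow.homMk (S.act.toCatHom : Cat.of (MObj F) ⟶ 𝒜) (𝟙 ℬ) (Cat.ext S.act_comp)
  unit := Arrow.hom_ext _ _ (Cat.ext S.unit) rfl
  assoc := Arrow.hom_ext _ _ (Cat.ext S.assoc.symm) rfl

/-- The morphism of algebras given by functors. -/
def mkHom {α β : RAlg.{u}} (H : α.A.left ⥤ β.A.left) (K : α.A.right ⟶ β.A.right)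
    (h : IsAlgHom (str α) (str β) H K.toFunctor) : α ⟶ β where
  f := Arrow.homMk H.toCatHom K (Cat.ext h.1.symm)
  h := Arrow.hom_ext _ _ (Cat.ext h.2) (by
    have h1 : α.a.right = 𝟙 α.A.right := algebra_a_right α
    have h2 : β.a.right = 𝟙 β.A.right := algebra_a_right β
    change K ≫ β.a.right = α.a.right ≫ K
    rw [h1, h2]
    exact (Category.comp_id K).trans (Category.id_comp K).symm)

lemma algHom_ext {α β : RAlg.{u}} {f g : α ⟶ β} (hl : f.f.left.toFunctor = g.f.left.toFunctor)
    (hr : f.f.right = g.f.right) : f = g :=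
  Monad.Algebra.Hom.ext (Arrow.hom_ext _ _ (Cat.ext hl) hr)

end Algebras

lemma right_eq_of_isHomLift {α β : RAlg.{u}} (g : α.A.right ⟶ β.A.right) (f : α ⟶ β)
    (h : algCod.IsHomLift g f) : f.f.right = g :=
  (@IsHomLift.eq_of_isHomLift _ _ _ _ algCod α β g f h).symm

/-! ### Limits of algebras, computed in `Cat`; the fibration and its fibred products. -/

section JointPullbacks

/-- The squares `(H i, K i) : F ⟶ G i` jointly exhibit `F` as a limit over `ℬ`: functors into `𝒜`
correspond to functors into `ℬ` together with compatible functors into the `𝒞 i`. -/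
structure JointPullback {ι : Type*} {𝒜 ℬ : Cat.{u, u}} (F : 𝒜 ⥤ ℬ) {𝒞 𝒟 : ι → Cat.{u, u}}
    (G : ∀ i, 𝒞 i ⥤ 𝒟 i) (H : ∀ i, 𝒜 ⥤ 𝒞 i) (K : ∀ i, ℬ ⥤ 𝒟 i) : Prop where
  w : ∀ i, F ⋙ K i = H i ⋙ G i
  exists_lift : ∀ (𝒯 : Type u) [Category.{u} 𝒯] (V : 𝒯 ⥤ ℬ) (T : ∀ i, 𝒯 ⥤ 𝒞 i),
    (∀ i, V ⋙ K i = T i ⋙ G i) → ∃ P : 𝒯 ⥤ 𝒜, P ⋙ F = V ∧ ∀ i, P ⋙ H i = T i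
  hom_ext : ∀ (𝒯 : Type u) [Category.{u} 𝒯] (P P' : 𝒯 ⥤ 𝒜), P ⋙ F = P' ⋙ F →
    (∀ i, P ⋙ H i = P' ⋙ H i) → P = P'

namespace JointPullback

variable {ι : Type*} {𝒜 ℬ : Cat.{u, u}} {F : 𝒜 ⥤ ℬ} {𝒞 𝒟 : ι → Cat.{u, u}} {G : ∀ i, 𝒞 i ⥤ 𝒟 i}
  {H : ∀ i, 𝒜 ⥤ 𝒞 i} {K : ∀ i, ℬ ⥤ 𝒟 i}

/-- Algebra structures lift along joint pullbacks. -/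
lemma exists_algStr (h : JointPullback F G H K) (S : ∀ i, AlgStr (G i)) :
    ∃ S' : AlgStr F, ∀ i, IsAlgHom S' (S i) (H i) (K i) := by
  -- The requirement that each projection be a morphism of algebras dictates the components of the
  -- action. The algebra laws then follow by joint uniqueness.
  obtain ⟨m, hm, hm'⟩ := h.exists_lift (MObj F) (rightFactor F)
    (fun i => mapFunctor (H i) (K i) (h.w i) ⋙ (S i).act) fun i =>
      (congrArg (mapFunctor (H i) (K i) (h.w i) ⋙ ·) (S i).act_comp.symm :)
  refine ⟨⟨m, hm, h.hom_ext _ _ _ ?_ fun i => ?_, h.hom_ext _ _ _ ?_ fun i => ?_⟩, fun i =>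
    ⟨h.w i, (hm' i).symm⟩⟩
  · exact (congrArg (leftFactor F ⋙ ·) hm :)
  · have h1 : (leftFactor F ⋙ m) ⋙ H i = (leftFactor F ⋙ mapFunctor (H i) (K i) (h.w i)) ⋙
        (S i).act := (congrArg (leftFactor F ⋙ ·) (hm' i) :)
    rw [h1, ← leftFactor_naturality]
    exact (congrArg (H i ⋙ ·) (S i).unit :)
  · exact (congrArg (mapFunctor (F := rightFactor F) (G := F) m (𝟭 ℬ) hm.symm ⋙ ·) hm :).trans
      (congrArg (mulFunctor F ⋙ ·) hm :).symm
  · have e1 : (mapFunctor (F := rightFactor F) (G := F) m (𝟭 ℬ) hm.symm ⋙ m) ⋙ H i =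
        (mapFunctor (F := rightFactor F) (G := F) m (𝟭 ℬ) hm.symm ⋙
          mapFunctor (H i) (K i) (h.w i)) ⋙ (S i).act :=
      (congrArg (mapFunctor (F := rightFactor F) (G := F) m (𝟭 ℬ) hm.symm ⋙ ·) (hm' i) :)
    have e2 : (mulFunctor F ⋙ m) ⋙ H i =
        (mulFunctor F ⋙ mapFunctor (H i) (K i) (h.w i)) ⋙ (S i).act :=
      (congrArg (mulFunctor F ⋙ ·) (hm' i) :)
    have w' : rightFactor F ⋙ K i = mapFunctor (H i) (K i) (h.w i) ⋙ rightFactor (G i) := rfl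
    have w₁ : rightFactor F ⋙ K i = (m ⋙ H i) ⋙ G i := by
      rw [hm']
      exact (congrArg (mapFunctor (H i) (K i) (h.w i) ⋙ ·) (S i).act_comp.symm :)
    have w₂ : rightFactor F ⋙ K i = (mapFunctor (H i) (K i) (h.w i) ⋙ (S i).act) ⋙ G i :=
      (congrArg (mapFunctor (H i) (K i) (h.w i) ⋙ ·) (S i).act_comp.symm :)
    -- `e3` and `e4` factor the same functor M(RF) ⥤ M(G i) in two ways: act first and then project,
    -- or project first and then act.
    have e3 := mapFunctor_comp (F := rightFactor F) (G := F) (I := G i) m (𝟭 ℬ) hm.symm (H i) (K i)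
      (h.w i) w₁
    have e4 := mapFunctor_comp (F := rightFactor F) (G := rightFactor (G i)) (I := G i)
      (mapFunctor (H i) (K i) (h.w i)) (K i) w' (S i).act (𝟭 _) (S i).act_comp.symm w₂
    have e5 : mapFunctor (F := rightFactor F) (G := G i) (m ⋙ H i) (𝟭 ℬ ⋙ K i) w₁ =
        mapFunctor (F := rightFactor F) (G := G i)
          (mapFunctor (H i) (K i) (h.w i) ⋙ (S i).act) (K i ⋙ 𝟭 _) w₂ :=
      mapFunctor_congr (hm' i) rfl _ _
    rw [e1, e2, ← e3, e5, e4, ← mulFunctor_naturality _ _ (h.w i) w']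
    exact (congrArg (mapFunctor (mapFunctor (H i) (K i) (h.w i)) (K i) w' ⋙ ·) (S i).assoc :)

/-- A functor into a joint pullback is a morphism of algebras if its components are. -/
lemma isAlgHom_of_comp (h : JointPullback F G H K) {S : ∀ i, AlgStr (G i)} {S' : AlgStr F}
    (hS : ∀ i, IsAlgHom S' (S i) (H i) (K i)) {𝒳 𝒴 : Type u} [Category.{u} 𝒳] [Category.{u} 𝒴]
    {J : 𝒳 ⥤ 𝒴} (S'' : AlgStr J) (P : 𝒳 ⥤ 𝒜) (V : 𝒴 ⥤ ℬ) (w : J ⋙ V = P ⋙ F)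
    (hP : ∀ i, IsAlgHom S'' (S i) (P ⋙ H i) (V ⋙ K i)) : IsAlgHom S'' S' P V := by
  refine ⟨w, h.hom_ext _ _ _ ?_ fun i => ?_⟩
  · have e1 : (mapFunctor P V w ⋙ S'.act) ⋙ F = rightFactor J ⋙ V :=
      (congrArg (mapFunctor P V w ⋙ ·) S'.act_comp :)
    have e2 : (S''.act ⋙ P) ⋙ F = S''.act ⋙ J ⋙ V := (congrArg (S''.act ⋙ ·) w :).symm
    rw [e1, e2]
    exact (congrArg (· ⋙ V) S''.act_comp :).symm
  · obtain ⟨w₁, h₁⟩ := hS i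
    obtain ⟨w₂, h₂⟩ := hP i
    have e1 : (mapFunctor P V w ⋙ S'.act) ⋙ H i =
        (mapFunctor P V w ⋙ mapFunctor (H i) (K i) w₁) ⋙ (S i).act :=
      (congrArg (mapFunctor P V w ⋙ ·) h₁ :).symm
    rw [e1, ← mapFunctor_comp P V w (H i) (K i) w₁ w₂]
    exact h₂

/-- A family of morphisms of algebras whose underlying squares form a joint pullback is jointly
cartesian. -/
lemma jointlyCartesian {ι : Type*} {γ : RAlg.{u}} {α : ι → RAlg.{u}} (f : ∀ i, γ ⟶ α i)
    (h : JointPullback (under γ) (fun i => under (α i)) (fun i => (f i).f.left.toFunctor)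
      (fun i => (f i).f.right.toFunctor)) :
    JointlyCartesian algCod.{u} (Y := fun i => (α i).A.right) (fun i => (f i).f.right) f where
  obj_eq := rfl
  isHomLift i := IsHomLift.map algCod (f i)
  exists_lift {V β} hβ g t ht := by
    subst hβ
    have ht' : ∀ i, (t i).f.right = g ≫ (f i).f.right := fun i =>
      right_eq_of_isHomLift _ _ (ht i)
    obtain ⟨P, hP, hP'⟩ := h.exists_lift β.A.left (under β ⋙ g.toFunctor)
      (fun i => (t i).f.left.toFunctor) fun i => by
        refine Eq.trans ?_ (hom_w (t i))
        rw [ht']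
        rfl
    have hom : IsAlgHom (str β) (str γ) P g.toFunctor :=
      h.isAlgHom_of_comp (fun i => hom_isAlgHom (f i)) (str β) P g.toFunctor hP.symm fun i => by
        have := hom_isAlgHom (t i)
        rw [ht', ← hP'] at this
        exact this
    exact ⟨mkHom P g hom, IsHomLift.map algCod (mkHom P g hom), fun i =>
      algHom_ext (hP' i) (ht' i).symm⟩
  hom_ext {V β} g k k' hk hk' e := by
    obtain rfl : algCod.obj β = V := IsHomLift.domain_eq algCod g k
    have e1 : k.f.right = g := right_eq_of_isHomLift _ _ hk
    have e2 : k'.f.right = g := right_eq_of_isHomLift _ _ hk'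
    refine algHom_ext (h.hom_ext _ _ _ ?_ fun i => ?_) (e1.trans e2.symm)
    · rw [← hom_w, ← hom_w, e1, e2]
    · exact congrArg (fun f => f.f.left.toFunctor) (e i)

end JointPullback

/-- The joint pullback of a family of cospans with a common leg source, in any category with small
limits. -/
lemma exists_joint_pullback_of_hasLimits {C : Type u₁} [Category.{v₁} C] [HasLimitsOfSize.{0, 0} C]
    {ι : Type} {b : C} {c d : ι → C} (g : ∀ i, c i ⟶ d i) (k : ∀ i, b ⟶ d i) :
    ∃ (a : C) (f : a ⟶ b) (h : ∀ i, a ⟶ c i), (∀ i, f ≫ k i = h i ≫ g i) ∧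
      (∀ (t : C) (v : t ⟶ b) (s : ∀ i, t ⟶ c i), (∀ i, v ≫ k i = s i ≫ g i) →
        ∃ p : t ⟶ a, p ≫ f = v ∧ ∀ i, p ≫ h i = s i) ∧
      ∀ (t : C) (p p' : t ⟶ a), p ≫ f = p' ≫ f → (∀ i, p ≫ h i = p' ≫ h i) → p = p' := by
  -- Each cospan is first pulled back to `b`, and the results are combined by a wide pullback over
  -- `b`. This also covers the empty family.
  let π : ∀ i, pullback (k i) (g i) ⟶ b := fun i => pullback.fst _ _
  refine ⟨widePullback b _ π, WidePullback.base π,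
    fun i => WidePullback.π π i ≫ pullback.snd (k i) (g i), fun i => ?_, fun t v s hs => ?_,
    fun t p p' hp hp' => ?_⟩
  · rw [← WidePullback.π_arrow π i, Category.assoc, Category.assoc, pullback.condition]
  · refine ⟨WidePullback.lift v (fun i => pullback.lift v (s i) (hs i))
      fun i => pullback.lift_fst _ _ _, ?_, fun i => ?_⟩
    · rw [WidePullback.lift_base]
    · rw [WidePullback.lift_π_assoc, pullback.lift_snd]
  · refine WidePullback.hom_ext π _ _ (fun i => pullback.hom_ext ?_ ?_) hp
    · change (_ ≫ _) ≫ π i = (_ ≫ _) ≫ π i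
      rw [Category.assoc, Category.assoc, WidePullback.π_arrow, hp]
    · rw [Category.assoc, Category.assoc, hp']

lemma exists_jointPullback {ι : Type} {ℬ : Cat.{u, u}} {𝒞 𝒟 : ι → Cat.{u, u}}
    (G : ∀ i, 𝒞 i ⥤ 𝒟 i) (K : ∀ i, ℬ ⥤ 𝒟 i) :
    ∃ (𝒜 : Cat.{u, u}) (F : 𝒜 ⥤ ℬ) (H : ∀ i, 𝒜 ⥤ 𝒞 i), JointPullback F G H K := by
  have : HasLimitsOfSize.{0, 0} Cat.{u, u} := hasLimitsOfSizeShrink.{0, 0, u, u} _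
  obtain ⟨a, f, h, hw, hl, he⟩ := exists_joint_pullback_of_hasLimits (b := ℬ)
    (fun i => ((G i).toCatHom : 𝒞 i ⟶ 𝒟 i)) (fun i => ((K i).toCatHom : ℬ ⟶ 𝒟 i))
  refine ⟨a, f.toFunctor, fun i => (h i).toFunctor, fun i => congrArg Cat.Hom.toFunctor (hw i),
    fun 𝒯 _ V T hT => ?_, fun 𝒯 _ P P' hP hP' => ?_⟩
  · obtain ⟨p, hp, hp'⟩ := hl (Cat.of 𝒯) V.toCatHom (fun i => (T i).toCatHom)
      fun i => Cat.ext (hT i)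
    exact ⟨p.toFunctor, congrArg Cat.Hom.toFunctor hp, fun i => congrArg Cat.Hom.toFunctor (hp' i)⟩
  · exact congrArg Cat.Hom.toFunctor
      (he (Cat.of 𝒯) P.toCatHom P'.toCatHom (Cat.ext hP) fun i => Cat.ext (hP' i))

/-- The joint pullbacks of algebras exist. -/
lemma exists_alg_jointPullback {ι : Type} (X : Cat.{u, u}) (α : ι → RAlg.{u})
    (K : ∀ i, X ⟶ (α i).A.right) :
    ∃ (𝒜 : Cat.{u, u}) (F : 𝒜 ⥤ X) (S : AlgStr F) (H : ∀ i, 𝒜 ⥤ (α i).A.left),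
      (∀ i, IsAlgHom S (str (α i)) (H i) (K i).toFunctor) ∧
      JointPullback F (fun i => under (α i)) H (fun i => (K i).toFunctor) := by
  obtain ⟨𝒜, F, H, h⟩ := exists_jointPullback (fun i => under (α i)) (fun i => (K i).toFunctor)
  obtain ⟨S, hS⟩ := h.exists_algStr (fun i => str (α i))
  exact ⟨𝒜, F, S, H, hS, h⟩

/-- Jointly cartesian families of algebras exist. -/
lemma exists_jointlyCartesian {ι : Type} (X : Cat.{u, u}) (α : ι → RAlg.{u}) {Y : ι → Cat.{u, u}}
    (hα : ∀ i, algCod.obj (α i) = Y i) (K : ∀ i, X ⟶ Y i) :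
    ∃ (γ : RAlg.{u}) (f : ∀ i, γ ⟶ α i), JointlyCartesian algCod.{u} K f := by
  obtain rfl : (fun i => (α i).A.right) = Y := funext hα
  obtain ⟨𝒜, F, S, H, hS, h⟩ := exists_alg_jointPullback X α K
  let f : ∀ i, mkAlg F S ⟶ α i := fun i => mkHom (α := mkAlg F S) (H i) (K i) (hS i)
  exact ⟨mkAlg F S, f, JointPullback.jointlyCartesian f h⟩

end JointPullbacks

instance algCod_isFibered : algCod.{u}.IsFibered :=
  isFibered_of_jointlyCartesian fun {X _} K α hα => by
    obtain ⟨γ, f, h⟩ := exists_jointlyCartesian X (fun _ : Unit => α) (fun _ => hα) (fun _ => K)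
    exact ⟨γ, f (), h⟩

lemma algCod_hasFibredProducts : HasFibredProducts algCod.{u} :=
  hasFibredProducts_of_jointlyCartesian fun _ X α hα =>
    exists_jointlyCartesian X α hα (fun _ => 𝟙 X)

/-! ### Functors into product categories, and strict equalities there. -/

section ProductCategories

variable {ℬ 𝒳 𝒟 : Type u} [Category.{u} ℬ] [Category.{u} 𝒳] [Category.{u} 𝒟]

lemma functor_prod_ext {K K' : 𝒟 ⥤ ℬ × 𝒳} (h₁ : K ⋙ CategoryTheory.Prod.fst ℬ 𝒳 = K' ⋙ CategoryTheory.Prod.fst ℬ 𝒳)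
    (h₂ : K ⋙ CategoryTheory.Prod.snd ℬ 𝒳 = K' ⋙ CategoryTheory.Prod.snd ℬ 𝒳) : K = K' := by
  have e : ∀ K : 𝒟 ⥤ ℬ × 𝒳, K = (K ⋙ CategoryTheory.Prod.fst ℬ 𝒳).prod' (K ⋙ CategoryTheory.Prod.snd ℬ 𝒳) := fun _ => rfl
  rw [e K, e K', h₁, h₂]

/-- An isomorphism of functors into a product from isomorphisms of the components. -/
def prodIso {K K' : 𝒟 ⥤ ℬ × 𝒳} (α : K ⋙ CategoryTheory.Prod.fst ℬ 𝒳 ≅ K' ⋙ CategoryTheory.Prod.fst ℬ 𝒳)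
    (β : K ⋙ CategoryTheory.Prod.snd ℬ 𝒳 ≅ K' ⋙ CategoryTheory.Prod.snd ℬ 𝒳) : K ≅ K' where
  hom := ⟨fun d => (α.hom.app d, β.hom.app d), fun _ _ f =>
    Prod.ext (α.hom.naturality f) (β.hom.naturality f)⟩
  inv := ⟨fun d => (α.inv.app d, β.inv.app d), fun _ _ f =>
    Prod.ext (α.inv.naturality f) (β.inv.naturality f)⟩
  hom_inv_id := NatTrans.ext (funext fun d => Prod.ext (α.hom_inv_id_app d) (β.hom_inv_id_app d))
  inv_hom_id := NatTrans.ext (funext fun d => Prod.ext (α.inv_hom_id_app d) (β.inv_hom_id_app d))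

lemma eqToHom_prod_fst {a b : ℬ × 𝒳} (h : a = b) :
    (eqToHom h).1 = eqToHom (congrArg _root_.Prod.fst h) := by
  subst h
  rfl

lemma eqToHom_prod_snd {a b : ℬ × 𝒳} (h : a = b) :
    (eqToHom h).2 = eqToHom (congrArg _root_.Prod.snd h) := by
  subst h
  rfl

/-- The objects are free variables so that the equalities can be eliminated by substitution; in the
application they are values of functors, where this is impossible. The later lemmas of this kind
have their form for the same reason. -/
lemma transport_iso_of_eq (P : ℬ ⥤ 𝒳) {x x' : 𝒳} {b b' b'' : ℬ} {u : x ⟶ x'} {hx : x = x'}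
    (hu : u = eqToHom hx) (f : x' ⟶ P.obj b) {v : b ⟶ b'} {h : b = b'} (hv : v = eqToHom h)
    (h' : b' = b'') (h'' : P.obj b = P.obj b'') :
    u ≫ f ≫ P.map v ≫ P.map (eqToHom h') = eqToHom hx ≫ f ≫ eqToHom h'' := by
  subst hx h h' hu hv
  simp

lemma transport_iso_comp (P : ℬ ⥤ 𝒳) {k k' m t : ℬ × 𝒳} (f' : k' ⟶ m) (e : m = k) (f : k ⟶ t)
    (g : t ⟶ k) (g' : m ⟶ k') (a : t.2 ⟶ P.obj t.1) {c c' : ℬ} (e' : k = m) (e₂ : m.2 = k.2)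
    (h₁ : k.1 = m.1) (h₂ : k'.1 = c) (h₃ : k'.1 = c') (h₄ : P.obj c' = P.obj c) :
    f'.2 ≫ eqToHom e₂ ≫ (f.2 ≫ a ≫ P.map g.1 ≫ P.map (eqToHom h₁)) ≫ P.map g'.1 ≫
      P.map (eqToHom h₂) =
    𝟙 k'.2 ≫ ((f' ≫ eqToHom e ≫ f).2 ≫ a ≫ P.map ((g ≫ eqToHom e') ≫ g').1 ≫
      P.map (eqToHom h₃)) ≫ eqToHom h₄ := by
  subst e h₂ h₃
  simp

end ProductCategories

/-! ### The algebra of pairs (A, x : X ≅ P(FA)) over the product of the bases. -/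

section Sigma

variable {𝒜 ℬ 𝒳 : Type u} [Category.{u} 𝒜] [Category.{u} ℬ] [Category.{u} 𝒳] {F : 𝒜 ⥤ ℬ}
  {𝒟 : Type u} [Category.{u} 𝒟]

/-- The functor `M (F ⋙ P) ⥤ ℬ × 𝒳`, `(A, x : X ≅ P (F A)) ↦ (F A, X)`. -/
def sigmaFunctor (F : 𝒜 ⥤ ℬ) (P : ℬ ⥤ 𝒳) : MObj (F ⋙ P) ⥤ ℬ × 𝒳 :=
  (srcFunctor (F ⋙ P) ⋙ F).prod' (rightFactor (F ⋙ P))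

variable (S : AlgStr F) (P : ℬ ⥤ 𝒳)

/-- The first component of an isomorphism into a functor factoring through `sigmaFunctor`. -/
def fstIso {T : 𝒟 ⥤ MObj (F ⋙ P)} {K : 𝒟 ⥤ ℬ × 𝒳} (β : K ≅ T ⋙ sigmaFunctor F P) :
    K ⋙ CategoryTheory.Prod.fst ℬ 𝒳 ≅ (T ⋙ srcFunctor (F ⋙ P)) ⋙ F :=
  isoWhiskerRight β (CategoryTheory.Prod.fst ℬ 𝒳)

/-- The second component of an isomorphism into a functor factoring through `sigmaFunctor`. -/
def sndIso {T : 𝒟 ⥤ MObj (F ⋙ P)} {K : 𝒟 ⥤ ℬ × 𝒳} (β : K ≅ T ⋙ sigmaFunctor F P) :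
    K ⋙ CategoryTheory.Prod.snd ℬ 𝒳 ≅ T ⋙ rightFactor (F ⋙ P) :=
  isoWhiskerRight β (CategoryTheory.Prod.snd ℬ 𝒳)

/-- Transport in `M (F ⋙ P)`: the object `(A, x : X ≅ P (F A))` is sent along
`(w, q) : (B', X') ≅ (F A, X)` to `(w^* A, P(w)⁻¹ x q)`. -/
def sigmaTransport (T : 𝒟 ⥤ MObj (F ⋙ P)) (K : 𝒟 ⥤ ℬ × 𝒳) (β : K ≅ T ⋙ sigmaFunctor F P) :
    𝒟 ⥤ MObj (F ⋙ P) :=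
  liftM (S.transport (T ⋙ srcFunctor (F ⋙ P)) (K ⋙ CategoryTheory.Prod.fst ℬ 𝒳) (fstIso P β))
    (K ⋙ CategoryTheory.Prod.snd ℬ 𝒳) (sndIso P β ≪≫ isoWhiskerLeft T (isoM (F ⋙ P)) ≪≫
      isoWhiskerRight (fstIso P β).symm P ≪≫
        isoWhiskerRight (eqIso (S.transport_comp _ _ (fstIso P β)).symm) P)

lemma sigmaTransport_comp (T : 𝒟 ⥤ MObj (F ⋙ P)) (K : 𝒟 ⥤ ℬ × 𝒳)
    (β : K ≅ T ⋙ sigmaFunctor F P) : sigmaTransport S P T K β ⋙ sigmaFunctor F P = K :=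
  functor_prod_ext (S.transport_comp _ _ (fstIso P β)) rfl

lemma sigmaTransport_of_eq {T : 𝒟 ⥤ MObj (F ⋙ P)} {K : 𝒟 ⥤ ℬ × 𝒳}
    {β : K ≅ T ⋙ sigmaFunctor F P} (h : K = T ⋙ sigmaFunctor F P)
    (hβ : ∀ d, β.hom.app d = eqToHom (Functor.congr_obj h d)) :
    sigmaTransport S P T K β = T := by
  have hβ' : ∀ d, β.inv.app d = eqToHom (Functor.congr_obj h d).symm := fun d => by
    rw [← cancel_mono (β.hom.app d), β.inv_hom_id_app, hβ, eqToHom_trans, eqToHom_refl]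
  have e1 : K ⋙ CategoryTheory.Prod.fst ℬ 𝒳 = (T ⋙ srcFunctor (F ⋙ P)) ⋙ F :=
    (congrArg (· ⋙ CategoryTheory.Prod.fst ℬ 𝒳) h :)
  refine functor_ext_to_M (S.transport_of_eq e1 fun d => ?_) (congrArg (· ⋙ CategoryTheory.Prod.snd ℬ 𝒳) h :)
    fun d => ?_
  · exact (congrArg _root_.Prod.fst (hβ d)).trans (eqToHom_prod_fst _)
  · exact transport_iso_of_eq P ((congrArg _root_.Prod.snd (hβ d)).trans (eqToHom_prod_snd _)) _
      ((congrArg _root_.Prod.fst (hβ' d)).trans (eqToHom_prod_fst _))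
      (Functor.congr_obj (S.transport_comp _ _ (fstIso P β)).symm d) _

/-- The sources compose by associativity in `S`. For the isomorphisms, transport along (w, q) and
then (w', q') gives P(w')⁻¹ P(w)⁻¹ x q q', which is P(w w')⁻¹ x (q q') by functoriality of P. -/
lemma sigmaTransport_sigmaTransport (T : 𝒟 ⥤ MObj (F ⋙ P)) (K K' : 𝒟 ⥤ ℬ × 𝒳)
    (β : K ≅ T ⋙ sigmaFunctor F P)
    (β' : K' ≅ sigmaTransport S P T K β ⋙ sigmaFunctor F P) :
    sigmaTransport S P (sigmaTransport S P T K β) K' β' =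
      sigmaTransport S P T K' (β' ≪≫ eqIso (sigmaTransport_comp S P T K β) ≪≫ β) := by
  refine functor_ext_to_M ?_ rfl fun d => ?_
  · refine (S.transport_transport _ _ _ (fstIso P β) (fstIso P β')).trans
      (S.transport_congr rfl rfl fun d => ?_)
    change (β'.hom.app d).1 ≫ eqToHom (Functor.congr_obj (S.transport_comp _ _ (fstIso P β)) d) ≫
      (β.hom.app d).1 = 𝟙 _ ≫ (β'.hom.app d ≫
        eqToHom (Functor.congr_obj (sigmaTransport_comp S P T K β) d) ≫ β.hom.app d).1 ≫ 𝟙 _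
    rw [Category.id_comp, Category.comp_id, prod_comp_fst, prod_comp_fst, eqToHom_prod_fst]
  · refine Eq.trans ?_ (transport_iso_comp P (β'.hom.app d)
      (Functor.congr_obj (sigmaTransport_comp S P T K β) d) (β.hom.app d) (β.inv.app d)
      (β'.inv.app d) (T.obj d).iso.hom (Functor.congr_obj (sigmaTransport_comp S P T K β) d).symm
      rfl (Functor.congr_obj (S.transport_comp _ _ (fstIso P β)).symm d)
      (Functor.congr_obj (S.transport_comp _ _ (fstIso P β')).symm d)
      (Functor.congr_obj (S.transport_comp _ _ (fstIso P (β' ≪≫ eqIso _ ≪≫ β))).symm d) _)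
    exact congrArg ((β'.hom.app d).2 ≫ ·) (Category.id_comp _).symm

/-- The algebra structure on `sigmaFunctor F P`. -/
def sigmaStr : AlgStr (sigmaFunctor F P) where
  act := sigmaTransport S P (srcFunctor _) (rightFactor _) (isoM _)
  act_comp := sigmaTransport_comp S P _ _ _
  unit := sigmaTransport_of_eq S P (T := 𝟭 (MObj (F ⋙ P))) (K := sigmaFunctor F P)
    (β := Iso.refl _) rfl fun _ => rfl
  assoc := by
    have h := sigmaTransport_comp S P (srcFunctor (sigmaFunctor F P)) (rightFactor _) (isoM _)
    let Q := srcFunctor (rightFactor (sigmaFunctor F P))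
    rw [mapFunctor_eq_liftM]
    have e := sigmaTransport_sigmaTransport S P (Q ⋙ srcFunctor (sigmaFunctor F P))
      (Q ⋙ rightFactor (sigmaFunctor F P)) (rightFactor (rightFactor (sigmaFunctor F P)))
      (isoWhiskerLeft Q (isoM (sigmaFunctor F P))) (isoM (rightFactor (sigmaFunctor F P)) ≪≫
        isoWhiskerLeft Q (eqIso h.symm) :)
    have e' : ∀ {β β' : rightFactor (rightFactor (sigmaFunctor F P)) ≅
        (Q ⋙ srcFunctor (sigmaFunctor F P)) ⋙ sigmaFunctor F P},
        (∀ d, β.hom.app d = β'.hom.app d) →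
        sigmaTransport S P _ _ β = sigmaTransport S P _ _ β' := fun {β β'} h => by
      rw [show β = β' from Iso.ext (NatTrans.ext (funext h))]
    refine e.trans (e' (β' := isoM (rightFactor (sigmaFunctor F P)) ≪≫
      isoWhiskerLeft Q (isoM (sigmaFunctor F P))) fun d => ?_)
    exact comp_eqToHom_comp_eqToHom_comp _ (Functor.congr_obj h.symm d.src)
      (Functor.congr_obj h d.src) _

end Sigma

section EqToHom

variable {ℬ 𝒳 : Type u} [Category.{u} ℬ] [Category.{u} 𝒳] (P : ℬ ⥤ 𝒳)

lemma sigma_unit_iso {b t c c' : ℬ} (f : b ⟶ t) (g : t ⟶ b) (h : f ≫ g = 𝟙 b) (hc : b = c)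
    (e : P.obj c' = P.obj b) (e' : P.obj c = P.obj c') :
    𝟙 (P.obj c') = eqToHom e ≫ ((P.map f ≫ 𝟙 _) ≫ 𝟙 _ ≫ P.map (𝟙 _ ≫ g) ≫
      P.map (eqToHom hc)) ≫ eqToHom e' := by
  subst hc
  simp [← P.map_comp_assoc, h]

lemma comp_id_map_id_map_eqToHom {x : 𝒳} {b b' : ℬ} (a : x ⟶ P.obj b) (h : b = b')
    (h' : P.obj b = P.obj b') :
    a ≫ 𝟙 _ ≫ P.map (𝟙 b) ≫ P.map (eqToHom h) = 𝟙 _ ≫ a ≫ eqToHom h' := by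
  subst h
  simp

lemma comp_eqToHom_eq {x y z w : ℬ} (f : x ⟶ y) (h : y = z) (h' : y = w) (h'' : w = z) :
    f ≫ eqToHom h = 𝟙 x ≫ (f ≫ eqToHom h') ≫ eqToHom h'' := by
  subst h h'
  simp

lemma comp_eqToHom_eq_id_comp {x y z : ℬ} (f : x ⟶ y) (h : y = z) (h' : z = y) :
    f = 𝟙 x ≫ (f ≫ eqToHom h) ≫ eqToHom h' := by
  simp

lemma sigma_desc_iso {k₁ t₁ c : ℬ} {k₂ t₂ : 𝒳} (i₁ : k₁ ⟶ t₁) (i₂ : k₂ ⟶ t₂) (g₁ : t₁ ⟶ k₁)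
    (hg : g₁ ≫ i₁ = 𝟙 t₁) (a : t₂ ⟶ P.obj t₁) (hc : k₁ = c) {z₁ z₂ z₃ z₄ : ℬ × 𝒳}
    (h₁ : (c, P.obj c) = z₁) (h₂ : z₁ = z₂) (h₃ : z₂ = (k₁, P.obj k₁)) (h₄ : (t₁, P.obj t₁) = z₃)
    (h₅ : (t₁, t₂) = z₄) (h₆ : z₄ = (t₁, t₂)) (e : (c, k₂) = (k₁, k₂)) :
    ((Prod.mkHom (𝟙 c) (i₂ ≫ a ≫ P.map g₁ ≫ P.map (eqToHom hc)) ≫ eqToHom h₁) ≫ eqToHom h₂) ≫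
        eqToHom h₃ ≫ Prod.mkHom i₁ (P.map i₁) ≫ eqToHom h₄ =
      eqToHom e ≫ ((Prod.mkHom i₁ i₂ ≫ eqToHom h₅) ≫ eqToHom h₆ ≫
        Prod.mkHom (𝟙 t₁) a ≫ eqToHom h₄) ≫ 𝟙 z₃ := by
  subst hc h₁ h₂ h₄ h₅
  refine Prod.ext ?_ ?_
  · simp
  · simp [← P.map_comp, hg]

end EqToHom

/-! ### Universal property of the unit A ↦ (A, id). -/

section Sigma

variable {𝒜 ℬ 𝒳 : Type u} [Category.{u} 𝒜] [Category.{u} ℬ] [Category.{u} 𝒳] {F : 𝒜 ⥤ ℬ}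
  (S : AlgStr F) (P : ℬ ⥤ 𝒳) {𝒞 : Type u} [Category.{u} 𝒞] {G : 𝒞 ⥤ ℬ × 𝒳} (S' : AlgStr G)

/-- The functor `⟨1, P⟩`. -/
abbrev graph : ℬ ⥤ ℬ × 𝒳 := (𝟭 ℬ).prod' P

/-- The unit `A ↦ (A, id)` is a morphism of algebras over `⟨1, P⟩`. -/
lemma leftFactor_isAlgHom : IsAlgHom S (sigmaStr S P) (leftFactor (F ⋙ P)) (graph P) := by
  let β : rightFactor F ⋙ graph P ≅
      (srcFunctor F ⋙ leftFactor (F ⋙ P)) ⋙ sigmaFunctor F P :=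
    isoWhiskerRight (isoM F) (graph P) ≪≫ isoWhiskerLeft (srcFunctor F)
      (eqIso (rfl : F ⋙ graph P = leftFactor (F ⋙ P) ⋙ sigmaFunctor F P))
  refine IsAlgHom.of_transport rfl (functor_ext_to_M (S.transport_congr (U := srcFunctor F)
    (K := rightFactor F) (α := isoM F) (α' := fstIso P β) rfl rfl fun d => ?_)
    (congrArg (· ⋙ P) S.act_comp :) fun d => ?_)
  · change d.iso.hom = 𝟙 _ ≫ (d.iso.hom ≫ 𝟙 _) ≫ 𝟙 _
    simp
  · exact sigma_unit_iso P d.iso.hom d.iso.inv d.iso.hom_inv_id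
      (Functor.congr_obj (S.transport_comp _ _ (fstIso P β)).symm d) _ _

/-- The isomorphism `(F A, X) ≅ (F A, P (F A))` at the object `(A, x : X ≅ P (F A))`. -/
def sigmaIso (F : 𝒜 ⥤ ℬ) : sigmaFunctor F P ≅ srcFunctor (F ⋙ P) ⋙ F ⋙ graph P :=
  prodIso (Iso.refl (srcFunctor (F ⋙ P) ⋙ F)) (isoM (F ⋙ P))

/-- Transporting (A, id) along (id, x) leaves A fixed by the unit law and turns id into x. So the
objects (A, id) generate everything under transport. -/
lemma sigmaTransport_leftFactor : sigmaTransport S P (srcFunctor (F ⋙ P) ⋙ leftFactor (F ⋙ P))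
    (sigmaFunctor F P) (sigmaIso P F) = 𝟭 _ := by
  have h : S.transport (srcFunctor (F ⋙ P)) (srcFunctor (F ⋙ P) ⋙ F) (Iso.refl _) =
      srcFunctor (F ⋙ P) := S.transport_of_eq rfl fun _ => rfl
  refine functor_ext_to_M h rfl fun d => ?_
  exact comp_id_map_id_map_eqToHom P d.iso.hom
    (congrArg F.obj (Functor.congr_obj h.symm d)) _

variable {P} in
/-- The functor out of `M (F ⋙ P)` induced by a functor over `⟨1, P⟩` into an algebra. -/
def sigmaDesc {h : 𝒜 ⥤ 𝒞} (w : F ⋙ graph P = h ⋙ G) : MObj (F ⋙ P) ⥤ 𝒞 :=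
  S'.transport (srcFunctor (F ⋙ P) ⋙ h) (sigmaFunctor F P)
    (sigmaIso P F ≪≫ isoWhiskerLeft (srcFunctor (F ⋙ P)) (eqIso w) :)

variable {P} {h : 𝒜 ⥤ 𝒞} (w : F ⋙ graph P = h ⋙ G)

lemma sigmaDesc_comp : sigmaDesc S' w ⋙ G = sigmaFunctor F P :=
  S'.transport_comp _ _ _

lemma leftFactor_comp_sigmaDesc : leftFactor (F ⋙ P) ⋙ sigmaDesc S' w = h :=
  S'.transport_of_eq (U := h) (K := F ⋙ graph P)
    (α := isoWhiskerLeft (leftFactor (F ⋙ P))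
      (sigmaIso P F ≪≫ isoWhiskerLeft (srcFunctor (F ⋙ P)) (eqIso w) :)) w
    fun _ => Category.id_comp _

/-- Morphisms of algebras commute with transport, and by `sigmaTransport_leftFactor` the identity of
the domain is a transport of a functor factoring through the unit. -/
lemma eq_sigmaDesc {k : MObj (F ⋙ P) ⥤ 𝒞} (hk : IsAlgHom (sigmaStr S P) S' k (𝟭 _))
    (e : leftFactor (F ⋙ P) ⋙ k = h) : k = sigmaDesc S' w := by
  have h1 := hk.transport_comp (srcFunctor (F ⋙ P) ⋙ leftFactor (F ⋙ P)) (sigmaFunctor F P)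
    (sigmaIso P F)
  have h2 : (sigmaStr S P).transport (srcFunctor (F ⋙ P) ⋙ leftFactor (F ⋙ P)) (sigmaFunctor F P)
    (sigmaIso P F) = 𝟭 _ := sigmaTransport_leftFactor S P
  rw [h2] at h1
  refine h1.trans (S'.transport_congr (congrArg (srcFunctor (F ⋙ P) ⋙ ·) e :) rfl fun d => ?_)
  exact comp_eqToHom_eq ((sigmaIso P F).hom.app d)
    (Functor.congr_obj hk.1 ((leftFactor (F ⋙ P)).obj d.src)) (Functor.congr_obj w d.src) _

/-- Both ways round are iterated transports of `h`, so they fuse into single transports along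
composite isomorphisms. These agree because the factor P(w)⁻¹ in the transported pair cancels the
P(w) that comes from the graph. -/
lemma sigmaDesc_isAlgHom (hh : IsAlgHom S S' h (graph P)) :
    IsAlgHom (sigmaStr S P) S' (sigmaDesc S' w) (𝟭 _) := by
  have w' := sigmaDesc_comp S' w
  refine IsAlgHom.of_transport w'.symm ?_
  let Q := srcFunctor (sigmaFunctor F P)
  let Q' := Q ⋙ srcFunctor (F ⋙ P)
  -- On sources the action of `sigmaStr` is transport in `S`, which `h` carries to transport in
  -- `S'`.
  have hU : ((sigmaStr S P).act ⋙ srcFunctor (F ⋙ P)) ⋙ h = _ :=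
    hh.transport_comp Q' _ (fstIso P (isoM (sigmaFunctor F P)))
  let γ : sigmaFunctor F P ≅ (srcFunctor (F ⋙ P) ⋙ h) ⋙ G :=
    (sigmaIso P F ≪≫ isoWhiskerLeft (srcFunctor (F ⋙ P)) (eqIso w) :)
  have e1 : (sigmaStr S P).act ⋙ sigmaDesc S' w =
      S'.transport (((sigmaStr S P).act ⋙ srcFunctor (F ⋙ P)) ⋙ h)
        ((sigmaStr S P).act ⋙ sigmaFunctor F P) (isoWhiskerLeft (sigmaStr S P).act γ) := rfl
  have e2 := S'.transport_congr (α := isoWhiskerLeft (sigmaStr S P).act γ)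
    (α' := isoWhiskerLeft (sigmaStr S P).act γ ≪≫ eqIso (congrArg (· ⋙ G) hU)) hU rfl fun d =>
      (comp_eqToHom_eq_id_comp _ (Functor.congr_obj (congrArg (· ⋙ G) hU) d) _)
  have e3 := S'.transport_transport (Q' ⋙ h) (Q ⋙ sigmaFunctor F P)
    (rightFactor (sigmaFunctor F P)) (isoWhiskerLeft Q γ)
    (isoM (sigmaFunctor F P) ≪≫ isoWhiskerLeft Q (eqIso w'.symm) :)
  refine (e1.trans (e2.trans (S'.transport_transport _ _ _ _ _))).trans
    (Eq.trans (S'.transport_congr rfl (sigmaStr S P).act_comp fun d => ?_) e3.symm)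
  exact sigma_desc_iso P d.iso.hom.1 d.iso.hom.2 d.iso.inv.1
    (congrArg _root_.Prod.fst d.iso.inv_hom_id) d.src.iso.hom
    (Functor.congr_obj (S.transport_comp Q' _ (fstIso P (isoM (sigmaFunctor F P)))).symm d)
    (Functor.congr_obj w _) (Functor.congr_obj (congrArg (· ⋙ G) hU) d)
    (Functor.congr_obj (S'.transport_comp _ _ _) d) (Functor.congr_obj w d.src.src)
    (Functor.congr_obj w'.symm d.src) (Functor.congr_obj w' d.src)
    (Functor.congr_obj (sigmaStr S P).act_comp d)

end Sigma

section EqToHom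

variable {ℬ 𝒳 𝒲 : Type u} [Category.{u} ℬ] [Category.{u} 𝒳] [Category.{u} 𝒲] (P : ℬ ⥤ 𝒳)

lemma eq_of_comp_eqToHom {x y z x' y' z' : ℬ} {f : x ⟶ y} {f' : x' ⟶ y'} {hx : x = x'}
    {hz : z' = z} (h : y = z) (h' : y' = z') (hy : y' = y)
    (e : f ≫ eqToHom h = eqToHom hx ≫ (f' ≫ eqToHom h') ≫ eqToHom hz) :
    f = eqToHom hx ≫ f' ≫ eqToHom hy := by
  subst h h' hx hz
  simpa using e

lemma comp_eqToHom_comp_eqToHom_eq {x y y' z : ℬ} (f : x ⟶ y) (h : y = y') (h' : y' = z)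
    (h'' : y = z) : (f ≫ eqToHom h) ≫ eqToHom h' = 𝟙 x ≫ f ≫ eqToHom h'' := by
  simp

lemma sigma_map_fst {k t : ℬ × 𝒳} {z : 𝒲 × 𝒳} (u : ℬ ⥤ 𝒲) (i : k ⟶ t)
    (h : u.obj t.1 = z.1) (h' : (u.obj t.1, t.2) = z) :
    u.map i.1 ≫ eqToHom h =
      𝟙 _ ≫ (Prod.mkHom (u.map i.1) i.2 ≫ eqToHom h').1 ≫ 𝟙 _ := by
  subst h'
  simp

lemma sigma_map_iso (u : 𝒲 ⥤ ℬ) {k t : 𝒲 × 𝒳} (i : k ⟶ t) (g : t ⟶ k) {z : ℬ × 𝒳}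
    {a : t.2 ⟶ P.obj (u.obj t.1)} {a' : z.2 ⟶ P.obj z.1} {c : 𝒲} {c' c'' : ℬ} (hc : k.1 = c)
    {q : P.obj (u.obj c) ⟶ P.obj c'} {h₁ : P.obj (u.obj c) = P.obj c'} (hq : q = eqToHom h₁)
    (h₂ : (u.obj t.1, t.2) = z) (h₃ : z = (u.obj t.1, t.2)) {h₄ : P.obj (u.obj t.1) = P.obj z.1}
    {h₇ : z.2 = t.2} (ha : a' = eqToHom h₇ ≫ a ≫ eqToHom h₄) (h₅ : u.obj k.1 = c'')
    (h₆ : P.obj c'' = P.obj c') :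
    (i.2 ≫ a ≫ (u ⋙ P).map g.1 ≫ (u ⋙ P).map (eqToHom hc)) ≫ q =
      𝟙 _ ≫ ((Prod.mkHom (u.map i.1) i.2 ≫ eqToHom h₂).2 ≫ a' ≫
        P.map (eqToHom h₃ ≫ Prod.mkHom (u.map g.1) g.2).1 ≫ P.map (eqToHom h₅)) ≫
          eqToHom h₆ := by
  subst hc h₂ h₅ ha hq
  simp

end EqToHom

/-! ### Stability of the construction under base change, for Beck–Chevalley. -/

section MapFunctor

variable {𝒜 ℬ 𝒞 𝒯 : Type u} [Category.{u} 𝒜] [Category.{u} ℬ] [Category.{u} 𝒞] [Category.{u} 𝒯]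
  {F : 𝒜 ⥤ ℬ} {G : 𝒞 ⥤ ℬ} {H : 𝒜 ⥤ 𝒞} (w : F ⋙ 𝟭 ℬ = H ⋙ G)

lemma MObj.iso_hom_eq_of_eq {P Q : MObj F} (h : P = Q) :
    P.iso.hom = eqToHom (congrArg MObj.pt h) ≫ Q.iso.hom ≫
      eqToHom (congrArg (fun P : MObj F => F.obj P.src) h.symm) := by
  subst h
  simp

lemma mapFunctor_iso_hom (P : MObj F) : ((mapFunctor H (𝟭 ℬ) w).obj P).iso.hom =
    𝟙 _ ≫ P.iso.hom ≫ eqToHom (Functor.congr_obj w P.src) := by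
  rw [Category.id_comp]
  exact congrArg (P.iso.hom ≫ ·) (eqToHom_app w P.src)

/-- Functors into `M F`, where `F = H ⋙ G`, are determined by their composites with the projection
and with `M F ⥤ M G`. -/
lemma mapFunctor_hom_ext {R R' : 𝒯 ⥤ MObj F} (hs : R ⋙ srcFunctor F = R' ⋙ srcFunctor F)
    (hm : R ⋙ mapFunctor H (𝟭 ℬ) w = R' ⋙ mapFunctor H (𝟭 ℬ) w) : R = R' := by
  refine functor_ext_to_M hs (congrArg (· ⋙ rightFactor G) hm :) fun d => ?_
  have e := MObj.iso_hom_eq_of_eq (Functor.congr_obj hm d)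
  change (R.obj d).iso.hom ≫ (eqToHom w).app _ = _ ≫ ((R'.obj d).iso.hom ≫ (eqToHom w).app _) ≫ _
    at e
  rw [eqToHom_app, eqToHom_app] at e
  exact eq_of_comp_eqToHom _ _ _ e

/-- Functors into `M F`, where `F = H ⋙ G`, correspond to compatible functors into `𝒜` and `M G`. -/
lemma mapFunctor_exists_lift (Q : 𝒯 ⥤ 𝒜) (T : 𝒯 ⥤ MObj G) (h : Q ⋙ H = T ⋙ srcFunctor G) :
    ∃ R : 𝒯 ⥤ MObj F, R ⋙ srcFunctor F = Q ∧ R ⋙ mapFunctor H (𝟭 ℬ) w = T := by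
  have e : (T ⋙ srcFunctor G) ⋙ G = Q ⋙ F :=
    (congrArg (· ⋙ G) h.symm :).trans (congrArg (Q ⋙ ·) w.symm :)
  refine ⟨liftM Q (T ⋙ rightFactor G) (isoWhiskerLeft T (isoM G) ≪≫ eqIso e :), rfl,
    functor_ext_to_M h rfl fun d => ?_⟩
  change ((T.obj d).iso.hom ≫ eqToHom (Functor.congr_obj e d)) ≫ (eqToHom w).app (Q.obj d) =
    𝟙 _ ≫ (T.obj d).iso.hom ≫ _
  rw [eqToHom_app]
  exact comp_eqToHom_comp_eqToHom_eq _ _ _ _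

end MapFunctor

section BeckChevalley

variable {𝒜 𝒞 𝒲 ℬ 𝒳 : Type u} [Category.{u} 𝒜] [Category.{u} 𝒞] [Category.{u} 𝒲] [Category.{u} ℬ]
  [Category.{u} 𝒳] {F : 𝒜 ⥤ 𝒲} {G : 𝒞 ⥤ ℬ} {H : 𝒜 ⥤ 𝒞} {u : 𝒲 ⥤ ℬ}

/-- The functor `M (F ⋙ u ⋙ P) ⥤ M (G ⋙ P)` induced by a square `(H, u) : F ⟶ G`. -/
def sigmaMap (w : F ⋙ u = H ⋙ G) (P : ℬ ⥤ 𝒳) : MObj (F ⋙ u ⋙ P) ⥤ MObj (G ⋙ P) :=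
  mapFunctor H (𝟭 𝒳) (congrArg (· ⋙ P) w :)

lemma sigmaMap_comp (w : F ⋙ u = H ⋙ G) (P : ℬ ⥤ 𝒳) :
    sigmaFunctor F (u ⋙ P) ⋙ u.prod (𝟭 𝒳) = sigmaMap w P ⋙ sigmaFunctor G P :=
  functor_prod_ext (congrArg (srcFunctor (F ⋙ u ⋙ P) ⋙ ·) w :) rfl

/-- On sources this is preservation of transport by `H`. On isomorphisms both sides compute
P(u(w))⁻¹ x q. -/
lemma sigmaMap_isAlgHom {S : AlgStr F} {S' : AlgStr G} (h : IsAlgHom S S' H u) (P : ℬ ⥤ 𝒳) :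
    IsAlgHom (sigmaStr S (u ⋙ P)) (sigmaStr S' P) (sigmaMap h.1 P) (u.prod (𝟭 𝒳)) := by
  have w := sigmaMap_comp h.1 P
  let Q := srcFunctor (sigmaFunctor F (u ⋙ P))
  let β : rightFactor (sigmaFunctor F (u ⋙ P)) ⋙ u.prod (𝟭 𝒳) ≅
      (Q ⋙ sigmaMap h.1 P) ⋙ sigmaFunctor G P :=
    (isoWhiskerRight (isoM (sigmaFunctor F (u ⋙ P))) (u.prod (𝟭 𝒳)) ≪≫
      isoWhiskerLeft Q (eqIso w) :)
  have e1 := h.transport_comp (Q ⋙ srcFunctor (F ⋙ u ⋙ P))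
    (rightFactor (sigmaFunctor F (u ⋙ P)) ⋙ CategoryTheory.Prod.fst 𝒲 𝒳)
    (fstIso (u ⋙ P) (isoM (sigmaFunctor F (u ⋙ P))))
  refine IsAlgHom.of_transport w (functor_ext_to_M
    (e1.trans (S'.transport_congr (α' := fstIso P β) rfl rfl fun d => ?_)) rfl fun d => ?_)
  · exact sigma_map_fst (z := (sigmaMap h.1 P ⋙ sigmaFunctor G P).obj d.src) u d.iso.hom
      (Functor.congr_obj h.1 d.src.src) (Functor.congr_obj w d.src)
  · have w' : (F ⋙ u ⋙ P) ⋙ 𝟭 𝒳 = H ⋙ G ⋙ P := (congrArg (· ⋙ P) h.1 :)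
    exact sigma_map_iso P u (z := (sigmaMap h.1 P ⋙ sigmaFunctor G P).obj d.src)
      d.iso.hom d.iso.inv
      (Functor.congr_obj (S.transport_comp _ _ (fstIso (u ⋙ P)
        (isoM (sigmaFunctor F (u ⋙ P))))).symm d) (eqToHom_app w' _) (Functor.congr_obj w d.src)
      (Functor.congr_obj w d.src).symm (h₇ := rfl) (mapFunctor_iso_hom w' d.src)
      (Functor.congr_obj (S'.transport_comp _ _ (fstIso P β)).symm d) _

end BeckChevalley

section BeckChevalley

variable {𝒜 𝒞 𝒲 ℬ 𝒳 : Cat.{u, u}} {F : 𝒜 ⥤ 𝒲} {G : 𝒞 ⥤ ℬ} {H : 𝒜 ⥤ 𝒞} {u : 𝒲 ⥤ ℬ}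

/-- If `(H, u) : F ⟶ G` is a pullback square, then so is the square induced on `sigmaFunctor`. -/
lemma sigmaMap_jointPullback
    (h : JointPullback F (fun _ : Unit => G) (fun _ => H) (fun _ => u)) (P : ℬ ⥤ 𝒳) :
    JointPullback (𝒜 := Cat.of (MObj (F ⋙ u ⋙ P))) (ℬ := Cat.of (𝒲 × 𝒳))
      (𝒞 := fun _ => Cat.of (MObj (G ⋙ P))) (𝒟 := fun _ => Cat.of (ℬ × 𝒳))
      (sigmaFunctor F (u ⋙ P)) (fun _ : Unit => sigmaFunctor G P)
      (fun _ => sigmaMap (h.w ()) P) (fun _ => u.prod (𝟭 𝒳)) where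
  w _ := sigmaMap_comp (h.w ()) P
  exists_lift 𝒯 _ V T hT := by
    have e : V ⋙ u.prod (𝟭 𝒳) = T () ⋙ sigmaFunctor G P := hT ()
    obtain ⟨Q, hQ, hQ'⟩ := h.exists_lift 𝒯 (V ⋙ CategoryTheory.Prod.fst 𝒲 𝒳)
      (fun _ => T () ⋙ srcFunctor (G ⋙ P)) fun _ =>
        (congrArg (· ⋙ CategoryTheory.Prod.fst ℬ 𝒳) e :)
    have w : (F ⋙ u ⋙ P) ⋙ 𝟭 _ = H ⋙ G ⋙ P := (congrArg (· ⋙ P) (h.w ()) :)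
    obtain ⟨R, hR, hR'⟩ := mapFunctor_exists_lift w Q (T ()) (hQ' ())
    refine ⟨R, functor_prod_ext ?_ ?_, fun _ => hR'⟩
    · exact (congrArg (· ⋙ F) hR :).trans hQ
    · exact (congrArg (· ⋙ rightFactor (G ⋙ P)) hR' :).trans
        (congrArg (· ⋙ CategoryTheory.Prod.snd ℬ 𝒳) e :).symm
  hom_ext 𝒯 _ R R' e e' := by
    refine mapFunctor_hom_ext _ (h.hom_ext _ _ _ ?_ fun _ => ?_) (e' ())
    · exact (congrArg (· ⋙ CategoryTheory.Prod.fst 𝒲 𝒳) e :)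
    · exact (congrArg (· ⋙ srcFunctor (G ⋙ P)) (e' ()) :)

end BeckChevalley

/-! ### Products with the algebra of pairs, for Frobenius reciprocity. -/

section Frobenius

/-- The squares `(H₁, K₁) : F ⟶ G₁` and `(H₂, K₂) : F ⟶ G₂` jointly exhibit `F` as a limit. -/
structure PullbackPair {𝒬 𝒲 𝒜₁ ℬ₁ 𝒜₂ ℬ₂ : Type u} [Category.{u} 𝒬] [Category.{u} 𝒲]
    [Category.{u} 𝒜₁] [Category.{u} ℬ₁] [Category.{u} 𝒜₂] [Category.{u} ℬ₂] (F : 𝒬 ⥤ 𝒲)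
    (G₁ : 𝒜₁ ⥤ ℬ₁) (G₂ : 𝒜₂ ⥤ ℬ₂) (H₁ : 𝒬 ⥤ 𝒜₁) (H₂ : 𝒬 ⥤ 𝒜₂) (K₁ : 𝒲 ⥤ ℬ₁) (K₂ : 𝒲 ⥤ ℬ₂) :
    Prop where
  w₁ : F ⋙ K₁ = H₁ ⋙ G₁
  w₂ : F ⋙ K₂ = H₂ ⋙ G₂
  exists_lift : ∀ (𝒯 : Type u) [Category.{u} 𝒯] (V : 𝒯 ⥤ 𝒲) (T₁ : 𝒯 ⥤ 𝒜₁) (T₂ : 𝒯 ⥤ 𝒜₂),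
    V ⋙ K₁ = T₁ ⋙ G₁ → V ⋙ K₂ = T₂ ⋙ G₂ →
      ∃ P : 𝒯 ⥤ 𝒬, P ⋙ F = V ∧ P ⋙ H₁ = T₁ ∧ P ⋙ H₂ = T₂
  hom_ext : ∀ (𝒯 : Type u) [Category.{u} 𝒯] (P P' : 𝒯 ⥤ 𝒬), P ⋙ F = P' ⋙ F →
    P ⋙ H₁ = P' ⋙ H₁ → P ⋙ H₂ = P' ⋙ H₂ → P = P'

lemma AlgStr.transport_transport_of_eq {𝒜 ℬ 𝒟 : Type u} [Category.{u} 𝒜] [Category.{u} ℬ]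
    [Category.{u} 𝒟] {F : 𝒜 ⥤ ℬ} (S : AlgStr F) {U : 𝒟 ⥤ 𝒜} {K K' : 𝒟 ⥤ ℬ} {α : K ≅ U ⋙ F}
    {β : K' ≅ S.transport U K α ⋙ F} (h : K' = U ⋙ F)
    (hα : ∀ d, β.hom.app d ≫ eqToHom (Functor.congr_obj (S.transport_comp U K α) d) ≫
      α.hom.app d = eqToHom (Functor.congr_obj h d)) :
    S.transport (S.transport U K α) K' β = U :=
  (S.transport_transport U K K' α β).trans (S.transport_of_eq h hα)

section

variable {ℬ 𝒳 : Type u} [Category.{u} ℬ] [Category.{u} 𝒳] (P : ℬ ⥤ 𝒳)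

lemma frobenius_iso {b : ℬ} {x : 𝒳} (f : x ⟶ P.obj b) (g : P.obj b ⟶ x) (h : g ≫ f = 𝟙 _)
    {b' : ℬ} {g' : P.obj b' ⟶ x} (hb : P.obj b' = P.obj b) (hg' : g' = eqToHom hb ≫ g)
    {z z' : ℬ × 𝒳} (h₁ : (b', x) = z) (h₂ : z = (b, x)) (h₃ : (b, P.obj b) = z')
    (h₄ : (b', P.obj b') = z') :
    (Prod.mkHom (𝟙 b') g' ≫ eqToHom h₁) ≫ eqToHom h₂ ≫ Prod.mkHom (𝟙 b) f ≫ eqToHom h₃ =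
      eqToHom h₄ := by
  obtain rfl : b' = b := congrArg _root_.Prod.fst (h₁.trans h₂)
  subst h₁ h₃ hg'
  refine Prod.ext ?_ ?_ <;> simp [h]

lemma frobenius_iso' {b : ℬ} {x : 𝒳} (f : x ⟶ P.obj b) (g : P.obj b ⟶ x) (h : f ≫ g = 𝟙 _)
    {z z' : ℬ × 𝒳} (h₁ : (b, P.obj b) = z) (h₂ : z = (b, P.obj b)) (h₃ : (b, x) = z') :
    (Prod.mkHom (𝟙 b) f ≫ eqToHom h₁) ≫ eqToHom h₂ ≫ Prod.mkHom (𝟙 b) g ≫ eqToHom h₃ =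
      eqToHom h₃ := by
  subst h₁ h₃
  refine Prod.ext ?_ ?_ <;> simp [h]

end

variable {𝒬 𝒜 ℬ 𝒳 𝒞 𝒯 : Type u} [Category.{u} 𝒬] [Category.{u} 𝒜] [Category.{u} ℬ]
  [Category.{u} 𝒳] [Category.{u} 𝒞] [Category.{u} 𝒯] {F : 𝒬 ⥤ ℬ} {F' : 𝒜 ⥤ ℬ} {P : ℬ ⥤ 𝒳}
  {G : 𝒞 ⥤ ℬ × 𝒳} (S' : AlgStr G)

/-- The transport of `T₁` along the inverses of the isomorphisms carried by `T₂`. -/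
def frobeniusInv (T₁ : 𝒯 ⥤ 𝒞) (T₂ : 𝒯 ⥤ MObj (F' ⋙ P))
    (h : T₂ ⋙ sigmaFunctor F' P = T₁ ⋙ G) : 𝒯 ⥤ 𝒞 :=
  S'.transport T₁ ((T₂ ⋙ srcFunctor (F' ⋙ P)) ⋙ F' ⋙ graph P)
    (isoWhiskerLeft T₂ (sigmaIso P F').symm ≪≫ eqIso h :)

lemma frobeniusInv_congr {T₁ T₁' : 𝒯 ⥤ 𝒞} {T₂ T₂' : 𝒯 ⥤ MObj (F' ⋙ P)}
    (h : T₂ ⋙ sigmaFunctor F' P = T₁ ⋙ G) (h' : T₂' ⋙ sigmaFunctor F' P = T₁' ⋙ G)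
    (e₁ : T₁ = T₁') (e₂ : T₂ = T₂') : frobeniusInv S' T₁ T₂ h = frobeniusInv S' T₁' T₂' h' := by
  subst e₁ e₂
  rfl

lemma frobeniusInv_comp (T₁ : 𝒯 ⥤ 𝒞) (T₂ : 𝒯 ⥤ MObj (F' ⋙ P))
    (h : T₂ ⋙ sigmaFunctor F' P = T₁ ⋙ G) :
    frobeniusInv S' T₁ T₂ h ⋙ G = (T₂ ⋙ srcFunctor (F' ⋙ P)) ⋙ F' ⋙ graph P :=
  S'.transport_comp _ _ _

/-- Transport back along (id, x) recovers `T₁`, since the two isomorphisms are mutually inverse. -/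
lemma frobeniusInv_injective {T₁ T₁' : 𝒯 ⥤ 𝒞} {T₂ : 𝒯 ⥤ MObj (F' ⋙ P)}
    (h : T₂ ⋙ sigmaFunctor F' P = T₁ ⋙ G) (h' : T₂ ⋙ sigmaFunctor F' P = T₁' ⋙ G)
    (e : frobeniusInv S' T₁ T₂ h = frobeniusInv S' T₁' T₂ h') : T₁ = T₁' := by
  have key : ∀ (T₁ : 𝒯 ⥤ 𝒞) (h : T₂ ⋙ sigmaFunctor F' P = T₁ ⋙ G),
      S'.transport (frobeniusInv S' T₁ T₂ h) (T₂ ⋙ sigmaFunctor F' P)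
        (isoWhiskerLeft T₂ (sigmaIso P F') ≪≫ eqIso (frobeniusInv_comp S' T₁ T₂ h).symm :) = T₁ :=
    fun T₁ h => S'.transport_transport_of_eq h fun d =>
      frobenius_iso' P (T₂.obj d).iso.hom (T₂.obj d).iso.inv (T₂.obj d).iso.hom_inv_id
        (Functor.congr_obj (frobeniusInv_comp S' T₁ T₂ h).symm d)
        (Functor.congr_obj (frobeniusInv_comp S' T₁ T₂ h) d) (Functor.congr_obj h d)
  rw [← key T₁ h, ← key T₁' h']
  exact S'.transport_congr e rfl fun d =>
    comp_eqToHom_eq _ (Functor.congr_obj (frobeniusInv_comp S' T₁ T₂ h).symm d)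
      (Functor.congr_obj (frobeniusInv_comp S' T₁' T₂ h').symm d) _

variable {q₁ : 𝒬 ⥤ 𝒞} {q₂ : 𝒬 ⥤ 𝒜} (w₁ : F ⋙ graph P = q₁ ⋙ G)

lemma mapFunctor_comp_sigmaFunctor (w : (F ⋙ P) ⋙ 𝟭 𝒳 = q₂ ⋙ F' ⋙ P) (w₂ : F = q₂ ⋙ F') :
    mapFunctor q₂ (𝟭 𝒳) w ⋙ sigmaFunctor F' P = sigmaFunctor F P :=
  functor_prod_ext (congrArg (srcFunctor (F ⋙ P) ⋙ ·) w₂.symm :) rfl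

/-- `sigmaDesc` sends (A, x) to the transport of q₁(A) along (id, x); transporting along the inverse
undoes this. -/
lemma frobeniusInv_sigmaDesc (w₂ : F = q₂ ⋙ F') (w : (F ⋙ P) ⋙ 𝟭 𝒳 = q₂ ⋙ F' ⋙ P)
    (h : mapFunctor q₂ (𝟭 𝒳) w ⋙ sigmaFunctor F' P = sigmaDesc S' w₁ ⋙ G) :
    frobeniusInv S' (sigmaDesc S' w₁) (mapFunctor q₂ (𝟭 𝒳) w) h = srcFunctor (F ⋙ P) ⋙ q₁ := by
  have e : (mapFunctor q₂ (𝟭 𝒳) w ⋙ srcFunctor (F' ⋙ P)) ⋙ F' ⋙ graph P =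
      (srcFunctor (F ⋙ P) ⋙ q₁) ⋙ G :=
    (congrArg (fun t => srcFunctor (F ⋙ P) ⋙ t ⋙ graph P) w₂ :).symm.trans
      (congrArg (srcFunctor (F ⋙ P) ⋙ ·) w₁ :)
  refine S'.transport_transport_of_eq e fun d => ?_
  refine frobenius_iso P d.iso.hom d.iso.inv d.iso.inv_hom_id
    (Functor.congr_obj w.symm d.src) ?_ (Functor.congr_obj h d)
    (Functor.congr_obj (sigmaDesc_comp S' w₁) d) (Functor.congr_obj w₁ d.src)
    (Functor.congr_obj e d)
  exact congrArg (· ≫ d.iso.inv) (eqToHom_app w.symm d.src)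

/-- If `F` is the fibrewise product of the reindexing of `G` along `⟨1, P⟩` with `F'`, then
`sigmaFunctor F P` is the fibrewise product of `G` with `sigmaFunctor F' P`. -/
lemma sigma_pullbackPair (h : PullbackPair F G F' q₁ q₂ (graph P) (𝟭 ℬ))
    (w : (F ⋙ P) ⋙ 𝟭 𝒳 = q₂ ⋙ F' ⋙ P) :
    PullbackPair (sigmaFunctor F P) G (sigmaFunctor F' P) (sigmaDesc S' h.w₁)
      (mapFunctor q₂ (𝟭 𝒳) w) (𝟭 _) (𝟭 _) where
  w₁ := (sigmaDesc_comp S' h.w₁).symm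
  w₂ := (mapFunctor_comp_sigmaFunctor w h.w₂).symm
  exists_lift 𝒯 _ V T₁ T₂ hT₁ hT₂ := by
    have e : T₂ ⋙ sigmaFunctor F' P = T₁ ⋙ G := hT₂.symm.trans hT₁
    -- Once `T₁` has been moved over the graph, it pairs with the source part of `T₂` to give a
    -- functor into the original product; the isomorphisms of `T₂` supply the rest of `R`.
    obtain ⟨Q, hQ, hQ₁, hQ₂⟩ := h.exists_lift 𝒯 ((T₂ ⋙ srcFunctor (F' ⋙ P)) ⋙ F')
      (frobeniusInv S' T₁ T₂ e) (T₂ ⋙ srcFunctor (F' ⋙ P)) (frobeniusInv_comp S' T₁ T₂ e).symm rfl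
    obtain ⟨R, hR, hR'⟩ := mapFunctor_exists_lift w Q T₂ hQ₂
    have e' := (mapFunctor_comp_sigmaFunctor w h.w₂).trans (sigmaDesc_comp S' h.w₁).symm
    have eR : T₂ ⋙ sigmaFunctor F' P = (R ⋙ sigmaDesc S' h.w₁) ⋙ G := by
      rw [← hR']
      exact (congrArg (R ⋙ ·) e' :)
    refine ⟨R, functor_prod_ext ?_ ?_, frobeniusInv_injective S' eR e ?_, hR'⟩
    · exact (congrArg (· ⋙ F) hR :).trans (hQ.trans
        (congrArg (· ⋙ CategoryTheory.Prod.fst ℬ 𝒳) hT₂ :).symm)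
    · exact (congrArg (· ⋙ rightFactor (F' ⋙ P)) hR' :).trans
        (congrArg (· ⋙ CategoryTheory.Prod.snd ℬ 𝒳) hT₂ :).symm
    · rw [← hQ₁, ← hR]
      exact (frobeniusInv_congr S' eR (congrArg (R ⋙ ·) e' :) rfl hR'.symm).trans
        (congrArg (R ⋙ ·) (frobeniusInv_sigmaDesc S' h.w₁ h.w₂ w e') :)
  hom_ext 𝒯 _ R R' e e₁ e₂ := by
    have e' := (mapFunctor_comp_sigmaFunctor w h.w₂).trans (sigmaDesc_comp S' h.w₁).symm
    have key : ∀ R : 𝒯 ⥤ MObj (F ⋙ P), R ⋙ srcFunctor (F ⋙ P) ⋙ q₁ =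
        frobeniusInv S' (R ⋙ sigmaDesc S' h.w₁) (R ⋙ mapFunctor q₂ (𝟭 𝒳) w)
          (congrArg (R ⋙ ·) e' :) := fun R =>
      (congrArg (R ⋙ ·) (frobeniusInv_sigmaDesc S' h.w₁ h.w₂ w e') :).symm
    refine mapFunctor_hom_ext w (h.hom_ext _ _ _ ?_ ?_ ?_) e₂
    · exact (congrArg (· ⋙ CategoryTheory.Prod.fst ℬ 𝒳) e :)
    · exact (key R).trans ((frobeniusInv_congr S' _ _ e₁ e₂).trans (key R').symm)
    · exact (congrArg (· ⋙ srcFunctor (F' ⋙ P)) e₂ :)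

end Frobenius

/-! ### Cocartesian lifts of graphs, and the two conditions for algebras. -/

section Cocartesian

/-- The algebra on `sigmaFunctor`, for an algebra `α` over `W` and a functor `P : W ⟶ X`. -/
def sigmaAlg (α : RAlg.{u}) {X : Cat.{u, u}} (P : α.A.right ⟶ X) : RAlg.{u} :=
  mkAlg (𝒜 := Cat.of (MObj (under α ⋙ P.toFunctor))) (ℬ := α.A.right ⊗ X)
    (sigmaFunctor (under α) P.toFunctor) (sigmaStr (str α) P.toFunctor)

/-- The cocartesian lift of `⟨1, P⟩` starting at `α`. -/
def sigmaUnit (α : RAlg.{u}) {X : Cat.{u, u}} (P : α.A.right ⟶ X) : α ⟶ sigmaAlg α P :=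
  mkHom (β := sigmaAlg α P) (leftFactor (under α ⋙ P.toFunctor)) (lift (𝟙 _) P)
    (leftFactor_isAlgHom (str α) P.toFunctor)

lemma sigmaUnit_isCocartesian (α : RAlg.{u}) {X : Cat.{u, u}} (P : α.A.right ⟶ X) :
    algCod.{u}.IsCocartesian (lift (𝟙 α.A.right) P) (sigmaUnit α P) where
  toIsHomLift := IsHomLift.map algCod (sigmaUnit α P)
  universal_property {β} f hf := by
    -- The codomain of `β` is only propositionally the required product; splitting `β` exposes it as
    -- a variable that can be substituted.
    obtain ⟨⟨l, r, m⟩, a, un, as⟩ := β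
    obtain rfl : r = α.A.right ⊗ X := IsHomLift.codomain_eq algCod (lift (𝟙 α.A.right) P) f
    have hr : f.f.right = lift (𝟙 α.A.right) P := right_eq_of_isHomLift _ f hf
    have hom := hom_isAlgHom f
    rw [hr] at hom
    let g : sigmaAlg α P ⟶ ⟨⟨l, _, m⟩, a, un, as⟩ :=
      mkHom (α := sigmaAlg α P) (sigmaDesc (str ⟨⟨l, _, m⟩, a, un, as⟩) hom.1) (𝟙 _)
        (sigmaDesc_isAlgHom (str α) (str ⟨⟨l, _, m⟩, a, un, as⟩) hom.1 hom)
    refine ⟨g, ⟨IsHomLift.map algCod g, ?_⟩, ?_⟩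
    · exact algHom_ext (leftFactor_comp_sigmaDesc (str ⟨⟨l, _, m⟩, a, un, as⟩) hom.1)
        ((Category.comp_id _).trans hr.symm)
    · rintro k ⟨hk, hk'⟩
      have hkr : k.f.right = 𝟙 _ := right_eq_of_isHomLift _ k hk
      have hkh := hom_isAlgHom k
      rw [hkr] at hkh
      exact algHom_ext (eq_sigmaDesc (str α) (str ⟨⟨l, _, m⟩, a, un, as⟩) hom.1 hkh
        (congrArg (fun f => f.f.left.toFunctor) hk')) hkr

lemma exists_isCocartesian {W X : Cat.{u, u}} (P : W ⟶ X) (A : Fiber algCod.{u} W) :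
    ∃ (C : RAlg.{u}) (i : A.1 ⟶ C), algCod.IsCocartesian (lift (𝟙 W) P) i := by
  obtain ⟨α, rfl⟩ := A
  exact ⟨_, _, sigmaUnit_isCocartesian α P⟩

end Cocartesian

lemma algCod_isIso_beckChevalleyMap {W W' X : Cat.{u, u}} (v : W ⟶ W') (P : W' ⟶ X)
    (h : v ≫ lift (𝟙 W') P = lift (𝟙 W) (v ≫ P) ≫ v ▷ X)
    {L : Fiber algCod.{u} W ⥤ Fiber algCod.{u} (W ⊗ X)}
    {L' : Fiber algCod.{u} W' ⥤ Fiber algCod.{u} (W' ⊗ X)}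
    (adj : L ⊣ reindex algCod (lift (𝟙 W) (v ≫ P)))
    (adj' : L' ⊣ reindex algCod (lift (𝟙 W') P)) (A : Fiber algCod.{u} W') :
    IsIso (beckChevalleyMap algCod h adj adj' A) := by
  obtain ⟨α, rfl⟩ := A
  obtain ⟨𝒜, F, S, H, hS, hF⟩ := exists_alg_jointPullback W (fun _ : Unit => α) (fun _ => v)
  let c : mkAlg F S ⟶ α := mkHom (α := mkAlg F S) (H ()) v (hS ())
  let k : sigmaAlg (mkAlg F S) (v ≫ P) ⟶ sigmaAlg α P :=
    mkHom (α := sigmaAlg (mkAlg F S) (v ≫ P)) (β := sigmaAlg α P)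
      (sigmaMap (hS ()).1 P.toFunctor) (v ▷ X) (sigmaMap_isAlgHom (hS ()) P.toFunctor)
  have hc : JointlyCartesian algCod.{u} (fun _ : Unit => v) (fun _ => c) :=
    JointPullback.jointlyCartesian (fun _ : Unit => c) hF
  have hc' := hc.isStronglyCartesian
  have hk : JointlyCartesian algCod.{u} (fun _ : Unit => v ▷ X) (fun _ => k) :=
    JointPullback.jointlyCartesian (fun _ : Unit => k)
      (sigmaMap_jointPullback hF P.toFunctor)
  refine isIso_beckChevalleyMap h adj adj' ⟨α, rfl⟩ (c := c) (k := k) inferInstance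
    (sigmaUnit_isCocartesian α P) (sigmaUnit_isCocartesian (mkAlg F S) (v ≫ P)) hk ?_
  exact algHom_ext (leftFactor_naturality _ _ _).symm rfl

section

lemma JointlyCartesian.pair {E : Type u₂} {B : Type u₁} [Category.{v₂} E] [Category.{v₁} B]
    {p : E ⥤ B} {X : B} {Y : Bool → B} {K : ∀ i, X ⟶ Y i} {γ : E} {α : Bool → E}
    {f : ∀ i, γ ⟶ α i} (h : JointlyCartesian p K f) :
    JointlyCartesianPair p (K true) (K false) (f true) (f false) where
  obj_eq := h.obj_eq
  isHomLift := by rintro (_ | _); exacts [h.isHomLift false, h.isHomLift true]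
  exists_lift hβ g t ht := by
    obtain ⟨k, hk, hk'⟩ := h.exists_lift hβ g
      (fun i => match i with | true => t true | false => t false)
      (by rintro (_ | _); exacts [ht false, ht true])
    exact ⟨k, hk, by rintro (_ | _); exacts [hk' false, hk' true]⟩
  hom_ext g k k' hk hk' e := h.hom_ext g k k' hk hk'
    (by rintro (_ | _); exacts [e false, e true])

lemma JointPullback.pair {𝒜 ℬ : Cat.{u, u}} {F : 𝒜 ⥤ ℬ} {𝒞 𝒟 : Bool → Cat.{u, u}}
    {G : ∀ i, 𝒞 i ⥤ 𝒟 i} {H : ∀ i, 𝒜 ⥤ 𝒞 i} {K : ∀ i, ℬ ⥤ 𝒟 i} (h : JointPullback F G H K) :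
    PullbackPair F (G true) (G false) (H true) (H false) (K true) (K false) where
  w₁ := h.w true
  w₂ := h.w false
  exists_lift 𝒯 _ V T₁ T₂ h₁ h₂ := by
    obtain ⟨Q, hQ, hQ'⟩ := h.exists_lift 𝒯 V
      (fun i => match i with | true => T₁ | false => T₂) (by rintro (_ | _); exacts [h₂, h₁])
    exact ⟨Q, hQ, hQ' true, hQ' false⟩
  hom_ext 𝒯 _ Q Q' e e₁ e₂ := h.hom_ext _ _ _ e (by rintro (_ | _); exacts [e₂, e₁])

lemma PullbackPair.jointlyCartesian {γ α₁ α₂ : RAlg.{u}} {f₁ : γ ⟶ α₁} {f₂ : γ ⟶ α₂}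
    (h : PullbackPair (under γ) (under α₁) (under α₂) f₁.f.left.toFunctor f₂.f.left.toFunctor
      f₁.f.right.toFunctor f₂.f.right.toFunctor) :
    JointlyCartesianPair algCod.{u} (Y₁ := α₁.A.right) (Y₂ := α₂.A.right)
      f₁.f.right f₂.f.right f₁ f₂ := by
  refine JointlyCartesian.pair (JointPullback.jointlyCartesian
    (α := boolPair (C := fun _ => RAlg.{u}) α₁ α₂)
    (boolPair (C := fun i => γ ⟶ boolPair (C := fun _ => RAlg.{u}) α₁ α₂ i) f₁ f₂)
    ⟨?_, fun 𝒯 _ V T hT => ?_, fun 𝒯 _ Q Q' e e' => ?_⟩)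
  · rintro (_ | _)
    exacts [h.w₂, h.w₁]
  · obtain ⟨Q, hQ, hQ₁, hQ₂⟩ := h.exists_lift 𝒯 V (T true) (T false) (hT true) (hT false)
    exact ⟨Q, hQ, by rintro (_ | _); exacts [hQ₂, hQ₁]⟩
  · exact h.hom_ext 𝒯 Q Q' e (e' true) (e' false)

end

lemma algCod_isIso_frobeniusMap {W X : Cat.{u, u}} (P : W ⟶ X)
    [HasFiniteProducts (Fiber algCod.{u} W)] [HasFiniteProducts (Fiber algCod.{u} (W ⊗ X))]
    {L : Fiber algCod.{u} W ⥤ Fiber algCod.{u} (W ⊗ X)}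
    (adj : L ⊣ reindex algCod (lift (𝟙 W) P)) (A : Fiber algCod.{u} W)
    (C : Fiber algCod.{u} (W ⊗ X)) : IsIso (frobeniusMap algCod adj A C) := by
  obtain ⟨α, rfl⟩ := A
  obtain ⟨⟨⟨l, r, m⟩, a, un, as⟩, hβ⟩ := C
  obtain rfl : r = α.A.right ⊗ X := hβ
  let β : RAlg.{u} := ⟨⟨l, _, m⟩, a, un, as⟩
  -- One joint pullback, of `β` along the graph and of `α` along the identity, gives the product of
  -- the reindexed `β` with `α`.
  obtain ⟨𝒬, F, S, H, hS, hF⟩ := exists_alg_jointPullback (algCod.obj α)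
    (boolPair (C := fun _ => RAlg.{u}) β α)
    (boolPair (C := fun i => α.A.right ⟶ (boolPair (C := fun _ => RAlg.{u}) β α i).A.right)
      (lift (𝟙 _) P) (𝟙 _))
  have hF' : PullbackPair F (under β) (under α) (H true) (H false) (graph P.toFunctor) (𝟭 _) :=
    hF.pair
  have h₁ : IsAlgHom S (str β) (H true) (graph P.toFunctor) := hS true
  have h₂ : IsAlgHom S (str α) (H false) (𝟭 _) := hS false
  let γ : RAlg.{u} := mkAlg F S
  let q₁ : γ ⟶ β := mkHom (α := γ) (H true) (lift (𝟙 _) P) (hS true)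
  let q₂ : γ ⟶ α := mkHom (α := γ) (H false) (𝟙 _) (hS false)
  let t₁ : sigmaAlg γ P ⟶ β := mkHom (α := sigmaAlg γ P) (sigmaDesc (str β) hF'.w₁) (𝟙 _)
    (sigmaDesc_isAlgHom S (str β) hF'.w₁ h₁)
  let t₂ : sigmaAlg γ P ⟶ sigmaAlg α P := mkHom (α := sigmaAlg γ P) (β := sigmaAlg α P)
    (sigmaMap h₂.1 P.toFunctor) (𝟙 _) (sigmaMap_isAlgHom h₂ P.toFunctor)
  have hq : JointlyCartesianPair algCod.{u} (lift (𝟙 _) P) (𝟙 _) q₁ q₂ :=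
    PullbackPair.jointlyCartesian (f₁ := q₁) (f₂ := q₂) hF'
  have ht : JointlyCartesianPair algCod.{u} (𝟙 (α.A.right ⊗ X)) (𝟙 (α.A.right ⊗ X)) t₁ t₂ :=
    PullbackPair.jointlyCartesian (f₁ := t₁) (f₂ := t₂)
      (sigma_pullbackPair (str β) hF' (congrArg (· ⋙ P.toFunctor) h₂.1 :))
  refine isIso_frobeniusMap adj ⟨α, rfl⟩ ⟨β, rfl⟩ hq (sigmaUnit_isCocartesian α P)
    (sigmaUnit_isCocartesian γ P) ht ?_ ?_
  · exact algHom_ext (leftFactor_comp_sigmaDesc (str β) hF'.w₁) (Category.comp_id _)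
  · exact algHom_ext (leftFactor_naturality _ _ _).symm rfl

end ElementaryFib

theorem proposition5p4 : ElementaryFib.IsElementaryFibration ElementaryFib.algCod.{u} := by
  open ElementaryFib CategoryTheory CartesianMonoidalCategory MonoidalCategory in
  -- By definition `parDiag Y X` is the graph of `snd Y X`.
  choose L adj using fun Y X : Cat.{u, u} =>
    exists_leftAdjoint (p := algCod.{u}) (d := parDiag Y X) (exists_isCocartesian (snd Y X))
  refine ⟨ElementaryFib.algCod_isFibered, ElementaryFib.algCod_hasFibredProducts, L,
    fun Y X => (adj Y X).some, fun Y X A C => ?_, fun Y Z f X A => ?_⟩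
  · have := ElementaryFib.algCod_hasFibredProducts.fibre
    exact ElementaryFib.algCod_isIso_frobeniusMap _ _ A C
  -- Here the base change is `f ▷ X` and P is `snd Z X`; their composite is `snd Y X`
  -- definitionally, so both diagonals are graphs of the required form.
  · exact ElementaryFib.algCod_isIso_beckChevalleyMap _ _
      (ElementaryFib.parDiag_naturality f X) (adj Y X).some (adj Z X).some A
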